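/- In a cube complex any two cubes that meet intersect in a common face. A cube complex is CAT(0) if it is simply connected and the link of each of its 0-cubes is a flag simplicial complex. Its dimension is the largest dimension of one of its cubes, and its maximum degree is the largest number of 1-cubes containing a given 0-cube. The hyperplanes of a cube complex correspond to the classes of the equivalence relation on 1-cubes generated by "being opposite edges of a 2-cube"; two distinct hyperplanes cross if some 2-cube has two consecutive edges dual to one and to the other. The crossing graph has the hyperplanes as vertices and the crossing pairs as edges. An isometric embedding of a CAT(0) cube complex $\mathbf X$ into a Cartesian product of trees $T_1\times\dots\times T_k$ is a map $f$ from the 0-cubes of $\mathbf X$ to the vertices of the product such that $d(x,y)=\sum_{i=1}^k d_{T_i}(f_i(x),f_i(y))$ for all $x,y$, where $d$ is the path metric of the 1-skeleton of $\mathbf X$ and $d_{T_i}$ is that of $T_i$. **Theorem.** (1) There is a constant $\Delta$ such that for every $n\ge 0$ there is a finite CAT(0) cube complex $\mathbf X_n$ of maximum degree $\Delta$ such that every colouring of the crossing graph of $\mathbf X_n$ requires more than $n$ colours, and every isometric embedding of $\mathbf X_n$ into a Cartesian product of finitely many trees requires more than $n$ trees. (2) There is an infinite CAT(0) cube complex $\mathbf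 X$ of dimension 5 and of finite maximum degree such that the crossing graph of $\mathbf X$ has infinite chromatic number, and $\mathbf X$ does not embed isometrically into any Cartesian product of finitely many trees. -/

import Mathlib

universe v w

/-- The face of the standard cube `{0,1}^d` obtained by fixing the coordinates in `S`
to the values prescribed by `a`. -/
def stdFace {d : ℕ} (S : Set (Fin d)) (a : Fin d → Bool) : Set (Fin d → Bool) :=
  {x | ∀ i ∈ S, x i = a i}

/-- `e` identifies the vertices of the standard `d`-cube with the set `c`, in such a way that the
members of `cubes` contained in `c` are exactly the images of the faces of the standard cube. -/
structure IsCubeParam {V : Type*} (cubes : Set (Set V)) {d : ℕ} (e : (Fin d → Bool) → V)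
    (c : Set V) : Prop where
  injective : Function.Injective e
  range_eq : Set.range e = c
  mem_iff : ∀ s : Set V, s ⊆ c →
    (s ∈ cubes ↔ ∃ (S : Set (Fin d)) (a : Fin d → Bool), s = e '' stdFace S a)

/-- A cube complex with set of `0`-cubes `V`, each cube being recorded by its set of vertices:
every point of `V` is a `0`-cube, every cube is combinatorially a standard cube with all its faces,
and two cubes that meet intersect in a common face (a cube contained in `c` is a face of `c`). -/
structure CubeComplex (V : Type*) where
  cubes : Set (Set V)
  singleton_mem : ∀ v : V, {v} ∈ cubes
  exists_param : ∀ c ∈ cubes, ∃ (d : ℕ) (e : (Fin d → Bool) → V), IsCubeParam cubes e c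
  inter_mem : ∀ c ∈ cubes, ∀ c' ∈ cubes, (c ∩ c').Nonempty → c ∩ c' ∈ cubes

namespace CubeComplex

variable {V : Type*} (X : CubeComplex V)

/-- `c` is a `d`-cube of `X`. -/
def IsCube (d : ℕ) (c : Set V) : Prop :=
  c ∈ X.cubes ∧ ∃ e : (Fin d → Bool) → V, IsCubeParam X.cubes e c

/-- The dimension of `X` is `d`: the largest dimension of a cube of `X`. -/
def HasDim (d : ℕ) : Prop :=
  IsGreatest {k : ℕ | ∃ c : Set V, X.IsCube k c} d

/-- The `1`-skeleton of `X`, as a graph. -/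
def skel : SimpleGraph V where
  Adj u v := u ≠ v ∧ ({u, v} : Set V) ∈ X.cubes
  symm := ⟨fun u v h => ⟨h.1.symm, by rw [Set.pair_comm]; exact h.2⟩⟩
  loopless := ⟨fun _ h => h.1 rfl⟩

/-- The largest degree of a `0`-cube of `X`, i.e. number of `1`-cubes containing it, is the
(finite) number `D`. -/
def HasMaxDegree (D : ℕ) : Prop :=
  IsGreatest (Set.range fun v : V => (X.skel.neighborSet v).encard) (D : ℕ∞)

/-- `a, b, c, d` are the vertices of a `2`-cube of `X`, listed in cyclic order. -/
structure IsSquare (a b c d : V) : Prop where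
  isCube : X.IsCube 2 {a, b, c, d}
  ab : X.skel.Adj a b
  bc : X.skel.Adj b c
  cd : X.skel.Adj c d
  da : X.skel.Adj d a

/-- Homotopy, with fixed endpoints, of paths in the `1`-skeleton: the equivalence relation
generated by inserting or deleting a backtrack and by replacing two consecutive edges of a
`2`-cube with the two other edges of that `2`-cube. -/
inductive PathHomotopic : {u v : V} → X.skel.Walk u v → X.skel.Walk u v → Prop
  | refl {u v : V} (p : X.skel.Walk u v) : PathHomotopic p p
  | symm {u v : V} {p q : X.skel.Walk u v} : PathHomotopic p q → PathHomotopic q p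
  | trans {u v : V} {p q r : X.skel.Walk u v} :
      PathHomotopic p q → PathHomotopic q r → PathHomotopic p r
  | cons {u v w : V} (h : X.skel.Adj u v) {p q : X.skel.Walk v w} :
      PathHomotopic p q → PathHomotopic (.cons h p) (.cons h q)
  | backtrack {u v w : V} (h : X.skel.Adj u v) (p : X.skel.Walk u w) :
      PathHomotopic (.cons h (.cons h.symm p)) p
  | square {a b c d w : V} (h : X.IsSquare a b c d) (p : X.skel.Walk c w) :
      PathHomotopic (.cons h.ab (.cons h.bc p)) (.cons h.da.symm (.cons h.cd.symm p))

/-- `X` is simply connected: it is (nonempty and) connected and its edge-path group is trivial. -/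
def IsSimplyConnected : Prop :=
  X.skel.Connected ∧ ∀ (v : V) (p : X.skel.Walk v v), X.PathHomotopic p .nil

/-- The simplices of the link of the `0`-cube `v`. The vertices of the link are the neighbours of
`v`, one for each `1`-cube at `v`; a cube containing `v` gives the simplex spanned by the
neighbours of `v` in this cube. (The cube `{v}` gives the empty simplex.) -/
def link (v : V) : Set (Set V) :=
  {S | ∃ c ∈ X.cubes, v ∈ c ∧ S = {u | u ∈ c ∧ X.skel.Adj v u}}

/-- The link of `v` is a flag complex: every finite set of vertices of the link which are pairwise
joined by an edge of the link spans a simplex. -/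
def IsFlagLink (v : V) : Prop :=
  ∀ S : Set V, S.Finite → (∀ u ∈ S, X.skel.Adj v u) →
    (∀ u ∈ S, ∀ w ∈ S, u ≠ w → ({u, w} : Set V) ∈ X.link v) → S ∈ X.link v

/-- `X` is a CAT(0) cube complex: simply connected, with flag links. -/
def IsCAT0 : Prop :=
  X.IsSimplyConnected ∧ ∀ v : V, X.IsFlagLink v

/-- Two `1`-cubes are opposite edges of a `2`-cube. -/
def Opposite (e f : X.skel.edgeSet) : Prop :=
  ∃ a b c d : V, X.IsSquare a b c d ∧ (e : Sym2 V) = s(a, b) ∧ (f : Sym2 V) = s(d, c)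

/-- The hyperplanes of `X`, a hyperplane being given by the set of `1`-cubes dual to it: these are
the classes of the equivalence relation on `1`-cubes generated by `Opposite`. -/
def Hyperplane : Type _ := Quot X.Opposite

/-- The hyperplane dual to a `1`-cube. -/
def dualHyperplane (e : X.skel.edgeSet) : X.Hyperplane := Quot.mk _ e

/-- The crossing graph of `X`: its vertices are the hyperplanes, and two distinct hyperplanes are
adjacent if they cross, i.e. if they are dual to two consecutive edges of some `2`-cube. -/
def crossingGraph : SimpleGraph X.Hyperplane where
  Adj H H' := H ≠ H' ∧ ∃ (a b c d : V) (h : X.IsSquare a b c d),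
    X.dualHyperplane ⟨s(a, b), h.ab⟩ = H ∧ X.dualHyperplane ⟨s(b, c), h.bc⟩ = H'
  symm := ⟨by
    rintro H H' ⟨hne, a, b, c, d, h, rfl, rfl⟩
    refine ⟨hne.symm, c, b, a, d, ⟨?_, h.bc.symm, h.ab.symm, h.da.symm, h.cd.symm⟩, ?_, ?_⟩
    · have hs : ({c, b, a, d} : Set V) = {a, b, c, d} := by
        ext x
        simp only [Set.mem_insert_iff, Set.mem_singleton_iff]
        tauto
      rw [hs]
      exact h.isCube
    · exact congrArg X.dualHyperplane (Subtype.ext Sym2.eq_swap)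
    · exact congrArg X.dualHyperplane (Subtype.ext Sym2.eq_swap)⟩
  loopless := ⟨fun _ h => h.1 rfl⟩

end CubeComplex

/-- `X` embeds isometrically into the Cartesian product of `k` trees: there is a map from the
vertices of `X` to those of the product that preserves distances, for the path metric of the
`1`-skeleton of `X` and for the sum of the path metrics of the trees. -/
def CubeComplex.EmbedsInTrees {V : Type v} (X : CubeComplex V) (k : ℕ) : Prop :=
  ∃ (T : Fin k → Type w) (G : ∀ i, SimpleGraph (T i)), (∀ i, (G i).IsTree) ∧
    ∃ f : V → ∀ i, T i, ∀ x y : V,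
      X.skel.dist x y = ∑ i, (G i).dist (f x i) (f y i)

/-! Both parts reduce to colouring. In an isometric embedding into `k` trees every edge moves
exactly one tree coordinate, and this coordinate colours the crossing graph with `k` colours
(`EmbedsInTrees.colorable`). So it suffices to make the chromatic number large while degree and
dimension stay bounded.

The complexes consist of finite sets of events. A `ConfigFamily` is governed by conditions on pairs,
hence stable under majorities: on any two elements the majority of three sets agrees with one of
them. This, with removal of elements one at a time, makes its complex CAT(0), and the edges flipping
a given element form one hyperplane.

Here the events move a point in the product of a path and a binary tree, and each box of that
product contributes an event compatible with the positions inside it. Boxes sharing a point give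
crossing hyperplanes. If at most three boxes share a point, a vertex has at most 2 + 4 + 3
neighbours, and a cube has dimension at most 1 + 1 + 3.

It remains to find boxes of bounded overlap without finite proper colouring, which is Burling's
construction. A probe is a ray to the right times the subtree below its word. Along it each box
contains all or none of that subtree, no two boxes meet, and its start is free of boxes, so that new
ones fit there. `BoxSystem.Forces.next` raises by one the number of colours that some probe must
see. All these systems are hung on disjoint branches of one tree (`exists_boxes`); bounding path and
tree gives the finite complexes, not bounding them the infinite one. -/

namespace CubeComplex

variable {V : Type*} {X : CubeComplex V}

/-! ### Edge-path homotopies and simple connectivity -/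

theorem PathHomotopic.append_right {u v w : V} {p q : X.skel.Walk u v}
    (h : X.PathHomotopic p q) (s : X.skel.Walk v w) :
    X.PathHomotopic (p.append s) (q.append s) := by
  induction h with
  | refl p => exact .refl _
  | symm _ ih => exact (ih s).symm
  | trans _ _ ih₁ ih₂ => exact (ih₁ s).trans (ih₂ s)
  | cons h _ ih => exact .cons h (ih s)
  | backtrack h p => exact .backtrack h (p.append s)
  | square h p => exact .square h (p.append s)

theorem PathHomotopic.append_left {u v w : V} (s : X.skel.Walk u v) {p q : X.skel.Walk v w}
    (h : X.PathHomotopic p q) : X.PathHomotopic (s.append p) (s.append q) := by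
  induction s with
  | nil => exact h
  | cons e _ ih => exact .cons e (ih h)

theorem pathHomotopic_append_reverse {u v : V} (p : X.skel.Walk u v) :
    X.PathHomotopic (p.append p.reverse) .nil := by
  induction p with
  | nil => exact .refl _
  | cons h p ih =>
    have h₁ := (ih.append_right (.cons h.symm .nil)).cons h
    rw [SimpleGraph.Walk.reverse_cons, SimpleGraph.Walk.cons_append,
      SimpleGraph.Walk.append_assoc]
    exact h₁.trans (.backtrack h .nil)

/-- A complex is simply connected as soon as its vertices are ranked so that there is only one
vertex without lower neighbour and any two lower neighbours of a vertex span a descending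
square with it. -/
theorem isSimplyConnected_of_rank (h : V → ℕ) (r : V) (hr : h r = 0)
    (hadj : ∀ u v, X.skel.Adj u v → h u < h v ∨ h v < h u)
    (hlow : ∀ v, v ≠ r → ∃ u, X.skel.Adj v u ∧ h u < h v)
    (hsq : ∀ v u w, X.skel.Adj v u → X.skel.Adj v w → h u < h v → h w < h v → u ≠ w →
      ∃ x, X.IsSquare v u x w ∧ h x < h u ∧ h x < h w) :
    X.IsSimplyConnected := by
  -- Paths to `r` are chosen rank by rank: a new vertex goes through one lower neighbour, and the
  -- descending square shows that any other lower neighbour gives a homotopic path.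
  have key : ∀ n : ℕ, ∃ g : ∀ v : V, h v < n → X.skel.Walk v r,
      ∀ (v u : V) (hv : h v < n) (hu : h u < n) (e : X.skel.Adj v u), h u < h v →
        X.PathHomotopic (g v hv) (.cons e (g u hu)) := by
    intro n
    induction n with
    | zero => exact ⟨fun v hv => absurd hv (by omega), fun v u hv => absurd hv (by omega)⟩
    | succ n ih =>
      obtain ⟨g, hg⟩ := ih
      have hex : ∀ v : V, ∀ hv : h v < n + 1, ∃ p : X.skel.Walk v r,
          (∀ hv' : h v < n, p = g v hv') ∧
          (¬ h v < n → ∀ (u : V) (hu : h u < n) (e : X.skel.Adj v u), h u < h v →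
            X.PathHomotopic p (.cons e (g u hu))) := by
        intro v hv
        by_cases hv' : h v < n
        · exact ⟨g v hv', fun _ => rfl, fun H => absurd hv' H⟩
        · by_cases hvr : v = r
          · subst hvr
            exact ⟨.nil, fun H => absurd H hv', fun _ u _ _ hu => by omega⟩
          · obtain ⟨w, hw, hwv⟩ := hlow v hvr
            have hwn : h w < n := by omega
            refine ⟨.cons hw (g w hwn), fun H => absurd H hv', ?_⟩
            intro _ u hu e huv
            by_cases huw : u = w
            · subst huw; exact .refl _
            · obtain ⟨x, hx, hxu, hxw⟩ := hsq v u w e hw huv hwv huw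
              have hxn : h x < n := by omega
              have h₁ := (hg u x hu hxn hx.bc hxu).cons e
              have h₂ := (hg w x hwn hxn hx.cd.symm hxw).cons hw
              exact h₂.trans ((PathHomotopic.square hx _).symm.trans h₁.symm)
      choose g' h1 h3 using hex
      refine ⟨g', fun v u hv hu e huv => ?_⟩
      have hun : h u < n := by omega
      rw [h1 u hu hun]
      by_cases hvn : h v < n
      · rw [h1 v hv hvn]; exact hg v u hvn hun e huv
      · exact h3 v hv hvn u hun e huv
  -- Coning off: `p` followed by the chosen path of its end is homotopic to the chosen path of its
  -- start. For a loop both chosen paths coincide, so `p` cancels. The choices need only cover the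
  -- finitely many ranks along `p`.
  have cone : ∀ {v w : V} (p : X.skel.Walk v w), ∃ (a : X.skel.Walk v r) (b : X.skel.Walk w r),
      X.PathHomotopic (p.append b) a ∧ (v = w → HEq a b) := by
    intro v w p
    obtain ⟨n, hn⟩ : ∃ n, ∀ x ∈ p.support, h x < n := by
      refine ⟨(p.support.map h).sum + 1, fun x hx => Nat.lt_succ_of_le ?_⟩
      exact List.le_sum_of_mem (List.mem_map_of_mem hx)
    obtain ⟨g, hg⟩ := key n
    refine ⟨g v (hn v p.start_mem_support), g w (hn w p.end_mem_support), ?_, ?_⟩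
    · induction p with
      | nil => exact .refl _
      | @cons a b c e p ih =>
        have hn' : ∀ x ∈ p.support, h x < n := fun x hx => hn x (by simp [hx])
        have ha := hn a (by simp)
        have hb := hn' b (by simp)
        refine ((ih hn').cons e).trans ?_
        rcases hadj a b e with hlt | hlt
        · exact ((hg b a hb ha e.symm hlt).cons e).trans (.backtrack e _)
        · exact (hg a b ha hb e hlt).symm
    · rintro rfl; rfl
  have hconn : ∀ v : V, X.skel.Reachable v r := by
    intro v
    obtain ⟨g, -⟩ := key (h v + 1)
    exact ⟨g v (by omega)⟩
  refine ⟨?_, fun v p => ?_⟩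
  · have : Nonempty V := ⟨r⟩
    exact ⟨fun u v => (hconn u).trans (hconn v).symm⟩
  · obtain ⟨a, b, hab, he⟩ := cone p
    obtain rfl : a = b := eq_of_heq (he rfl)
    have h₁ : X.PathHomotopic p (p.append (a.append a.reverse)) := by
      simpa using (PathHomotopic.append_left p (pathHomotopic_append_reverse a)).symm
    rw [SimpleGraph.Walk.append_assoc] at h₁
    exact h₁.trans ((hab.append_right _).trans (pathHomotopic_append_reverse a))

/-! ### Squares, and colourings from tree embeddings -/

theorem IsSquare.ncard_eq {a b c d : V} (h : X.IsSquare a b c d) :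
    ({a, b, c, d} : Set V).ncard = 4 := by
  obtain ⟨-, e, he⟩ := h.isCube
  rw [← he.range_eq, ← Set.image_univ, Set.ncard_image_of_injective _ he.injective,
    Set.ncard_univ]
  simp

theorem IsSquare.ne_ac {a b c d : V} (h : X.IsSquare a b c d) : a ≠ c := by
  rintro rfl
  have h₁ := h.ncard_eq
  rw [Set.insert_comm, Set.insert_eq_of_mem (Set.mem_insert a _)] at h₁
  have h₂ := Set.ncard_insert_le b ({a, d} : Set V)
  have h₃ := Set.ncard_insert_le a ({d} : Set V)
  rw [Set.ncard_singleton] at h₃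
  omega

theorem IsSquare.rotate {a b c d : V} (h : X.IsSquare a b c d) : X.IsSquare b c d a := by
  refine ⟨?_, h.bc, h.cd, h.da, h.ab⟩
  have hs : ({b, c, d, a} : Set V) = {a, b, c, d} := by
    ext x
    simp only [Set.mem_insert_iff, Set.mem_singleton_iff]
    tauto
  rw [hs]
  exact h.isCube

theorem IsSquare.ne_bd {a b c d : V} (h : X.IsSquare a b c d) : b ≠ d := h.rotate.ne_ac

/-- An edge has length 1, so its ends differ in a single coordinate, which serves as its colour.
Opposite edges of a square move the same coordinate and consecutive edges different ones, so the
colour passes to hyperplanes and is proper. -/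
theorem EmbedsInTrees.colorable {V : Type v} {X : CubeComplex V} {k : ℕ}
    (h : EmbedsInTrees.{v, w} X k) : X.crossingGraph.Colorable k := by
  obtain ⟨T, G, hT, f, hf⟩ := h
  have hinj : ∀ {x y : V}, X.skel.Reachable x y → f x = f y → x = y := by
    intro x y hr hxy
    refine hr.dist_eq_zero_iff.1 ?_
    rw [hf, hxy]
    simp
  have hedge : ∀ a b : V, X.skel.Adj a b →
      ∃ i, (G i).Adj (f a i) (f b i) ∧ ∀ j, j ≠ i → f a j = f b j := by
    intro a b hab
    have h1 : ∑ i, (G i).dist (f a i) (f b i) = 1 := by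
      rw [← hf, SimpleGraph.dist_eq_one_iff_adj.2 hab]
    obtain ⟨i, hi⟩ : ∃ i, (G i).dist (f a i) (f b i) ≠ 0 := by
      by_contra! H
      simp [H] at h1
    rw [← Finset.add_sum_erase _ _ (Finset.mem_univ i)] at h1
    refine ⟨i, SimpleGraph.dist_eq_one_iff_adj.1 (by omega), fun j hj => ?_⟩
    have h0 : ∑ x ∈ Finset.univ.erase i, (G x).dist (f a x) (f b x) = 0 := by omega
    have := (Finset.sum_eq_zero_iff.1 h0) j (by simp [hj])
    exact ((hT j).1.dist_eq_zero_iff).1 this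
  have hcol : ∀ e : X.skel.edgeSet, ∃ i, ∀ a b, (e : Sym2 V) = s(a, b) →
      (G i).Adj (f a i) (f b i) ∧ ∀ j, j ≠ i → f a j = f b j := by
    rintro ⟨e, he⟩
    induction e using Sym2.ind with
    | _ a b =>
      obtain ⟨i, hi, hj⟩ := hedge a b he
      refine ⟨i, fun x y hxy => ?_⟩
      rcases Sym2.eq_iff.1 hxy with ⟨rfl, rfl⟩ | ⟨rfl, rfl⟩
      · exact ⟨hi, hj⟩
      · exact ⟨hi.symm, fun j h => (hj j h).symm⟩
  choose col hc using hcol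
  have hsq : ∀ {a b c d : V} (h : X.IsSquare a b c d),
      col ⟨s(a, b), h.ab⟩ ≠ col ⟨s(b, c), h.bc⟩ ∧
      col ⟨s(a, b), h.ab⟩ = col ⟨s(d, c), h.cd.symm⟩ := by
    intro a b c d h
    obtain ⟨ab1, ab2⟩ := hc ⟨s(a, b), h.ab⟩ a b rfl
    obtain ⟨bc1, bc2⟩ := hc ⟨s(b, c), h.bc⟩ b c rfl
    obtain ⟨dc1, dc2⟩ := hc ⟨s(d, c), h.cd.symm⟩ d c rfl
    obtain ⟨ad1, ad2⟩ := hc ⟨s(a, d), h.da.symm⟩ a d rfl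
    have hac : f a ≠ f c := fun H => h.ne_ac (hinj (h.ab.reachable.trans h.bc.reachable) H)
    have hbd : f b ≠ f d := fun H => h.ne_bd (hinj (h.bc.reachable.trans h.cd.reachable) H)
    generalize col ⟨s(a, b), h.ab⟩ = i at *
    generalize col ⟨s(b, c), h.bc⟩ = j at *
    generalize col ⟨s(d, c), h.cd.symm⟩ = k at *
    generalize col ⟨s(a, d), h.da.symm⟩ = l at *
    -- Otherwise all four sides move coordinate `i`, giving two paths of length 2 in one tree with
    -- the same ends. By uniqueness of paths `b` and `d` have the same image.
    have hij : i ≠ j := by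
      rintro rfl
      have haci : f a i ≠ f c i := by
        intro H
        apply hac
        funext t
        by_cases ht : t = i
        · subst ht; exact H
        · rw [ab2 t ht, bc2 t ht]
      have hki : k = i := by
        by_contra hki
        by_cases hl : l = i
        · subst hl
          exact dc1.ne ((ad2 k hki).symm.trans ((ab2 k hki).trans (bc2 k hki)))
        · exact haci ((ad2 i (Ne.symm hl)).trans (dc2 i (Ne.symm hki)))
      subst hki
      have hli : l = k := by
        by_contra hl
        exact ad1.ne ((ab2 l hl).trans ((bc2 l hl).trans (dc2 l hl).symm))
      subst hli
      have hp : ∀ {x : T l} (h1 : (G l).Adj (f a l) x) (h2 : (G l).Adj x (f c l)),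
          (SimpleGraph.Walk.cons h1 (.cons h2 .nil)).IsPath := by
        intro x h1 h2
        simp [h1.ne, h2.ne, haci]
      have := congrArg Subtype.val (((hT l).2.subsingleton_path _ _).elim ⟨_, hp ab1 bc1⟩ ⟨_, hp ad1 dc1⟩)
      simp only [SimpleGraph.Walk.cons.injEq] at this
      apply hbd
      funext t
      by_cases ht : t = l
      · subst ht; exact this.1
      · rw [← ab2 t ht, ad2 t ht]
    refine ⟨hij, ?_⟩
    -- If opposite sides move different coordinates, the side `ad` must move `i` as well, and then
    -- `b` and `d` agree in every coordinate.
    by_contra hik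
    have hli : l = i := by
      by_contra hl
      exact ab1.ne ((ad2 i (Ne.symm hl)).trans ((dc2 i hik).trans (bc2 i hij).symm))
    subst hli
    apply hbd
    funext t
    by_cases ht : t = l
    · subst ht; rw [bc2 t hij, dc2 t hik]
    · rw [← ab2 t ht, ad2 t ht]
  refine ⟨SimpleGraph.Coloring.mk (Quot.lift col ?_) ?_⟩
  · rintro ⟨e, he⟩ ⟨e', he'⟩ ⟨a, b, c, d, h, rfl, rfl⟩
    exact (hsq h).2
  · rintro _ _ ⟨-, a, b, c, d, h, rfl, rfl⟩
    exact (hsq h).1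

end CubeComplex

/-! ### Configuration families and their CAT(0) complexes -/

/-- A family of finite subsets of `E` that contains the empty set, is described by conditions on
pairs of elements, and in which one descends from a member to a smaller one by removing elements
one at a time. -/
structure ConfigFamily (E : Type*) [DecidableEq E] where
  IsConfig : Finset E → Prop
  empty : IsConfig ∅
  of_pairs : ∀ w, (∀ a b, ∃ w', IsConfig w' ∧ (a ∈ w' ↔ a ∈ w) ∧ (b ∈ w' ↔ b ∈ w)) → IsConfig w
  exists_erase : ∀ u s, IsConfig u → IsConfig s → u ⊂ s → ∃ m ∈ s, m ∉ u ∧ IsConfig (s.erase m)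

namespace ConfigFamily

variable {E : Type*} [DecidableEq E] (Φ : ConfigFamily E)

/-- The intersection is the majority of `s`, `t` and `∅`, so on any two elements it agrees with one
of these three. -/
theorem inter {s t : Finset E} (hs : Φ.IsConfig s) (ht : Φ.IsConfig t) : Φ.IsConfig (s ∩ t) := by
  refine Φ.of_pairs _ fun a b => ?_
  by_cases h₁ : (a ∈ s ↔ a ∈ s ∩ t) ∧ (b ∈ s ↔ b ∈ s ∩ t)
  · exact ⟨s, hs, h₁⟩
  by_cases h₂ : (a ∈ t ↔ a ∈ s ∩ t) ∧ (b ∈ t ↔ b ∈ s ∩ t)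
  · exact ⟨t, ht, h₂⟩
  refine ⟨∅, Φ.empty, ?_⟩
  simp only [Finset.mem_inter, Finset.notMem_empty] at *
  tauto

/-- The vertices of the cube complex of a configuration family. -/
abbrev Vertex := {s : Finset E // Φ.IsConfig s}

/-- The configurations between `s` and `u`. -/
def icc (s u : Finset E) : Set Φ.Vertex := {v | s ⊆ v.1 ∧ v.1 ⊆ u}

/-- The sets of configurations that are the vertex sets of cubes. -/
def cubeSet : Set (Set Φ.Vertex) :=
  {c | ∃ s u, s ⊆ u ∧ (∀ w, s ⊆ w → w ⊆ u → Φ.IsConfig w) ∧ c = Φ.icc s u}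

/-- The coordinates are the elements of `u \ s`, a Boolean vector telling which of them to add to
`s`; faces correspond to subintervals. -/
theorem exists_param {s u : Finset E} (hsu : s ⊆ u)
    (h : ∀ w, s ⊆ w → w ⊆ u → Φ.IsConfig w) :
    ∃ e : (Fin (u \ s).card → Bool) → Φ.Vertex, IsCubeParam Φ.cubeSet e (Φ.icc s u) := by
  let φ := (u \ s).equivFin.symm
  let g : (Fin (u \ s).card → Bool) → Finset E := fun x =>
    s ∪ (Finset.univ.filter (fun i => x i = true)).image (fun i => (φ i : E))
  have hφ : ∀ i, (φ i : E) ∈ u ∧ (φ i : E) ∉ s := fun i => by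
    simpa only [Finset.mem_sdiff] using (φ i).2
  have hg : ∀ x a, a ∈ g x ↔ a ∈ s ∨ ∃ i, x i = true ∧ (φ i : E) = a := fun x a => by simp [g]
  have hgφ : ∀ x i, (φ i : E) ∈ g x ↔ x i = true := by
    intro x i
    rw [hg]
    constructor
    · rintro (h' | ⟨j, hj, hji⟩)
      · exact absurd h' (hφ i).2
      · rwa [← φ.injective (Subtype.ext hji)]
    · exact fun h' => Or.inr ⟨i, h', rfl⟩
  have hsg : ∀ x, s ⊆ g x := fun x => Finset.subset_union_left
  have hgu : ∀ x, g x ⊆ u := by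
    intro x a ha
    rcases (hg x a).1 ha with h' | ⟨i, -, rfl⟩
    · exact hsu h'
    · exact (hφ i).1
  have hsurj : ∀ a ∈ u, a ∉ s → ∃ i, (φ i : E) = a := fun a hau has =>
    ⟨φ.symm ⟨a, by simp [hau, has]⟩, by simp⟩
  have hle : ∀ {w w' : Finset E}, s ⊆ w' → w ⊆ u →
      (∀ i, (φ i : E) ∈ w → (φ i : E) ∈ w') → w ⊆ w' := by
    intro w w' h1 h2 h3 a ha
    by_cases has : a ∈ s
    · exact h1 has
    · obtain ⟨i, rfl⟩ := hsurj a (h2 ha) has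
      exact h3 i ha
  have heq : ∀ w, s ⊆ w → w ⊆ u → g (fun i => decide ((φ i : E) ∈ w)) = w := by
    intro w h1 h2
    refine subset_antisymm (hle h1 (hgu _) fun i hi => ?_) (hle (hsg _) h2 fun i hi => ?_)
    · simpa [hgφ] using hi
    · simpa [hgφ] using hi
  refine ⟨fun x => ⟨g x, h _ (hsg x) (hgu x)⟩, ⟨?_, ?_, ?_⟩⟩
  · intro x y hxy
    have hxy' : g x = g y := congrArg Subtype.val hxy
    funext i
    have := hgφ x i
    rw [hxy', hgφ] at this
    exact (Bool.eq_iff_iff.2 this).symm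
  · ext v
    constructor
    · rintro ⟨x, rfl⟩
      exact ⟨hsg x, hgu x⟩
    · rintro ⟨h1, h2⟩
      exact ⟨_, Subtype.ext (heq v.1 h1 h2)⟩
  · intro c hc
    constructor
    · rintro ⟨s₁, u₁, h₁, hconf, rfl⟩
      have hs₁ : s ⊆ s₁ := (hc (a := ⟨s₁, hconf _ subset_rfl h₁⟩) ⟨subset_rfl, h₁⟩).1
      have hu₁ : u₁ ⊆ u := (hc (a := ⟨u₁, hconf _ h₁ subset_rfl⟩) ⟨h₁, subset_rfl⟩).2
      -- The interval from `s₁` to `u₁` fixes the coordinates in `s₁` to true and those outside `u₁`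
      -- to false.
      refine ⟨{i | (φ i : E) ∈ s₁ ∨ (φ i : E) ∉ u₁}, fun i => decide ((φ i : E) ∈ s₁), ?_⟩
      ext v
      constructor
      · rintro ⟨h1, h2⟩
        refine ⟨_, ?_, Subtype.ext (heq v.1 (hs₁.trans h1) (h2.trans hu₁))⟩
        rintro i (hi | hi)
        · simp [hi, h1 hi]
        · have hi' : (φ i : E) ∉ s₁ := fun H => hi (h₁ H)
          have hi'' : (φ i : E) ∉ v.1 := fun H => hi (h2 H)
          simp [hi', hi'']
      · rintro ⟨x, hx, rfl⟩
        refine ⟨hle (hsg x) (h₁.trans hu₁) fun i hi => ?_,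
          hle (hs₁.trans h₁) (hgu x) fun i hi => ?_⟩
        · rw [hgφ, hx i (Or.inl hi)]
          simpa using hi
        · by_contra hiu
          have := hx i (Or.inr hiu)
          rw [(hgφ x i).1 hi] at this
          exact hiu (h₁ (by simpa using this.symm))
    · rintro ⟨S, a, rfl⟩
      classical
      -- The least and the greatest vertex of the face: free coordinates all false, then all true.
      refine ⟨g fun i => decide (i ∈ S ∧ a i = true), g fun i => decide (i ∈ S → a i = true),
        hle (hsg _) (hgu _) fun i hi => ?_, fun w h1 h2 => h w ((hsg _).trans h1)
          (h2.trans (hgu _)), ?_⟩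
      · simp only [hgφ, decide_eq_true_eq] at hi ⊢
        exact fun _ => hi.2
      ext v
      constructor
      · rintro ⟨x, hx, rfl⟩
        refine ⟨hle (hsg _) (hgu _) fun i hi => ?_, hle (hsg _) (hgu _) fun i hi => ?_⟩
        · simp only [hgφ, decide_eq_true_eq] at hi ⊢
          rw [hx i hi.1, hi.2]
        · simp only [hgφ, decide_eq_true_eq] at hi ⊢
          exact fun hS => by rw [← hx i hS, hi]
      · rintro ⟨h1, h2⟩
        refine ⟨_, ?_, Subtype.ext (heq v.1 ((hsg _).trans h1) (h2.trans (hgu _)))⟩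
        intro i hi
        rw [Bool.eq_iff_iff, decide_eq_true_eq]
        constructor
        · intro hv
          have := h2 hv
          simp only [hgφ, decide_eq_true_eq] at this
          exact this hi
        · intro ha
          apply h1
          simp [hgφ, hi, ha]

/-- The cube complex of a configuration family: its vertices are the configurations, and its
cubes are the intervals all of whose members are configurations. -/
def complex : CubeComplex Φ.Vertex where
  cubes := Φ.cubeSet
  singleton_mem v := by
    refine ⟨v.1, v.1, subset_rfl, fun w h1 h2 => subset_antisymm h1 h2 ▸ v.2, ?_⟩
    ext x
    simp only [Set.mem_singleton_iff, icc, Set.mem_ofPred_eq]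
    exact ⟨fun h => h ▸ ⟨subset_rfl, subset_rfl⟩, fun h => Subtype.ext (subset_antisymm h.2 h.1)⟩
  exists_param := by
    rintro c ⟨s, u, hsu, h, rfl⟩
    exact ⟨_, Φ.exists_param hsu h⟩
  inter_mem := by
    rintro c ⟨s, u, hsu, h, rfl⟩ c' ⟨s', u', hsu', h', rfl⟩ ⟨v, hv, hv'⟩
    refine ⟨s ∪ s', u ∩ u', ?_, ?_, ?_⟩
    · exact (Finset.union_subset hv.1 hv'.1).trans (Finset.subset_inter hv.2 hv'.2)
    · intro w h1 h2
      exact h w (Finset.subset_union_left.trans h1) (h2.trans Finset.inter_subset_left)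
    · ext x
      simp only [icc, Set.mem_inter_iff, Set.mem_ofPred_eq, Finset.union_subset_iff,
        Finset.subset_inter_iff]
      tauto

theorem isCube_icc {s u : Finset E} (hsu : s ⊆ u) (h : ∀ w, s ⊆ w → w ⊆ u → Φ.IsConfig w) :
    Φ.complex.IsCube (u \ s).card (Φ.icc s u) :=
  ⟨⟨s, u, hsu, h, rfl⟩, Φ.exists_param hsu h⟩

/-- A `d`-cube has `2 ^ d` vertices, so every parametrization of it has the same dimension as the
one by `u \ s`. -/
theorem exists_of_isCube {d : ℕ} {c : Set Φ.Vertex} (hc : Φ.complex.IsCube d c) :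
    ∃ s u, s ⊆ u ∧ (∀ w, s ⊆ w → w ⊆ u → Φ.IsConfig w) ∧ (u \ s).card = d := by
  obtain ⟨⟨s, u, hsu, h, rfl⟩, e, he⟩ := hc
  refine ⟨s, u, hsu, h, ?_⟩
  obtain ⟨e', he'⟩ := Φ.exists_param hsu h
  have h1 := Set.ncard_image_of_injective Set.univ he.injective
  have h2 := Set.ncard_image_of_injective Set.univ he'.injective
  rw [Set.image_univ, he.range_eq] at h1
  rw [Set.image_univ, he'.range_eq] at h2
  rw [h1] at h2
  simp only [Set.ncard_univ, Nat.card_eq_fintype_card, Fintype.card_pi, Fintype.card_bool,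
    Finset.prod_const, Finset.card_univ, Fintype.card_fin] at h2
  exact (Nat.pow_right_injective le_rfl h2).symm

theorem adj_of_insert {u v : Φ.Vertex} {e : E} (he : e ∉ u.1) (hv : v.1 = insert e u.1) :
    Φ.complex.skel.Adj u v := by
  refine ⟨fun h => he (by rw [h, hv]; simp), u.1, v.1, by simp [hv], ?_, ?_⟩
  · intro w h1 h2
    rw [hv] at h2
    by_cases hew : e ∈ w
    · have : w = v.1 := hv ▸ subset_antisymm h2 (Finset.insert_subset hew h1)
      exact this ▸ v.2
    · have : w = u.1 := subset_antisymm ((Finset.subset_insert_iff_of_notMem hew).1 h2) h1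
      exact this ▸ u.2
  · ext w
    simp only [Set.mem_insert_iff, Set.mem_singleton_iff, icc, Set.mem_ofPred_eq, hv]
    constructor
    · rintro (rfl | rfl)
      · simp
      · simp [hv]
    · rintro ⟨h1, h2⟩
      by_cases hew : e ∈ w.1
      · exact Or.inr (Subtype.ext (hv ▸ subset_antisymm h2 (Finset.insert_subset hew h1)))
      · exact Or.inl (Subtype.ext
          (subset_antisymm ((Finset.subset_insert_iff_of_notMem hew).1 h2) h1))

/-- A 1-cube is an interval with two members, so adding one element to its bottom already gives its
top. The right-hand side, "exactly `e` is flipped", is symmetric in `u` and `v` and does not record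
which of them is larger. -/
theorem adj_iff {u v : Φ.Vertex} :
    Φ.complex.skel.Adj u v ↔ ∃ e, ∀ x, (x ∈ u.1 ↔ x ∈ v.1) ↔ x ≠ e := by
  constructor
  · have main : ∀ (u v : Φ.Vertex), u ≠ v → u.1 ⊆ v.1 →
        (∀ w, u.1 ⊆ w → w ⊆ v.1 → ∃ h : Φ.IsConfig w, (⟨w, h⟩ : Φ.Vertex) = u ∨ ⟨w, h⟩ = v) →
        ∃ e, ∀ x, (x ∈ u.1 ↔ x ∈ v.1) ↔ x ≠ e := by
      intro u v hne huv h
      obtain ⟨e, hev, heu⟩ : ∃ e ∈ v.1, e ∉ u.1 := by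
        by_contra! H
        exact hne (Subtype.ext (subset_antisymm huv H))
      have hi : insert e u.1 = v.1 := by
        obtain ⟨h1, h2 | h2⟩ := h (insert e u.1) (by simp) (Finset.insert_subset hev huv)
        · exact absurd (congrArg Subtype.val h2 ▸ Finset.mem_insert_self e u.1 : e ∈ u.1) heu
        · exact congrArg Subtype.val h2
      refine ⟨e, fun x => ?_⟩
      rw [← hi, Finset.mem_insert]
      by_cases hx : x = e
      · subst hx; simp [heu]
      · simp [hx]
    rintro ⟨hne, s, t, hst, h, heq⟩
    have hmem : ∀ w, s ⊆ w → w ⊆ t →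
        ∃ h : Φ.IsConfig w, (⟨w, h⟩ : Φ.Vertex) = u ∨ ⟨w, h⟩ = v := by
      intro w h1 h2
      refine ⟨h w h1 h2, ?_⟩
      have : (⟨w, h w h1 h2⟩ : Φ.Vertex) ∈ ({u, v} : Set Φ.Vertex) := by
        rw [heq]; exact ⟨h1, h2⟩
      simpa using this
    have hu : u ∈ Φ.icc s t := by rw [← heq]; simp
    have hv : v ∈ Φ.icc s t := by rw [← heq]; simp
    obtain ⟨_, hs⟩ := hmem s subset_rfl hst
    obtain ⟨_, ht⟩ := hmem t hst subset_rfl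
    rcases hs with hs | hs
    · have hs' := congrArg Subtype.val hs
      simp only at hs'
      refine main u v hne (hs' ▸ hv.1) fun w h1 h2 => hmem w (hs' ▸ h1) (h2.trans hv.2)
    · have hs' := congrArg Subtype.val hs
      simp only at hs'
      obtain ⟨e, he⟩ := main v u hne.symm (hs' ▸ hu.1) fun w h1 h2 => by
        obtain ⟨a, b⟩ := hmem w (hs' ▸ h1) (h2.trans hu.2)
        exact ⟨a, b.symm⟩
      exact ⟨e, fun x => by rw [← he x]; exact iff_comm⟩
  · rintro ⟨e, he⟩
    by_cases heu : e ∈ u.1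
    · have hev : e ∉ v.1 := by have := he e; tauto
      refine (Φ.adj_of_insert hev ?_).symm
      ext x
      have := he x
      rw [Finset.mem_insert]
      by_cases hx : x = e
      · subst hx; tauto
      · tauto
    · refine Φ.adj_of_insert heu ?_
      ext x
      have := he x
      have := he e
      rw [Finset.mem_insert]
      by_cases hx : x = e
      · subst hx; tauto
      · tauto

theorem isSquare {w : Finset E} {a b : E} (hab : a ≠ b) (ha : a ∉ w) (hb : b ∉ w)
    (h : Φ.IsConfig w) (h1 : Φ.IsConfig (insert a w)) (h2 : Φ.IsConfig (insert b w))
    (h12 : Φ.IsConfig (insert b (insert a w))) :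
    Φ.complex.IsSquare ⟨w, h⟩ ⟨insert a w, h1⟩ ⟨insert b (insert a w), h12⟩ ⟨insert b w, h2⟩ := by
  have hcases : ∀ v, w ⊆ v → v ⊆ insert b (insert a w) →
      v = w ∨ v = insert a w ∨ v = insert b (insert a w) ∨ v = insert b w := by
    intro v hv hv'
    have key : ∀ t : Finset E, w ⊆ t → t ⊆ insert b (insert a w) → (a ∈ v ↔ a ∈ t) →
        (b ∈ v ↔ b ∈ t) → v = t := by
      intro t ht ht' h3 h4
      ext x
      have e1 := @hv x
      have e2 := @hv' x
      have e3 := @ht x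
      have e4 := @ht' x
      simp only [Finset.mem_insert] at e2 e4
      by_cases hxa : x = a
      · rw [hxa]; exact h3
      by_cases hxb : x = b
      · rw [hxb]; exact h4
      tauto
    by_cases hav : a ∈ v <;> by_cases hbv : b ∈ v
    · exact .inr (.inr (.inl (key _ (fun x hx => by simp [hx]) subset_rfl (by simp [hav])
        (by simp [hbv]))))
    · exact .inr (.inl (key _ (fun x hx => by simp [hx]) (fun x hx => by
        rw [Finset.mem_insert]; exact Or.inr hx) (by simp [hav]) (by simp [hbv, hb, hab.symm])))
    · exact .inr (.inr (.inr (key _ (fun x hx => by simp [hx]) (fun x hx => by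
        simp only [Finset.mem_insert] at hx ⊢; tauto) (by simp [hav, ha, hab]) (by simp [hbv]))))
    · exact .inl (key _ subset_rfl (fun x hx => by simp [hx]) (by simp [hav, ha])
        (by simp [hbv, hb]))
  have hba : b ∉ insert a w := by simp [hb, hab.symm]
  have hcard : (insert b (insert a w) \ w).card = 2 := by
    rw [Finset.card_sdiff_of_subset (fun x hx => by simp [hx]), Finset.card_insert_of_notMem hba,
      Finset.card_insert_of_notMem ha]
    omega
  have hcube := Φ.isCube_icc (s := w) (u := insert b (insert a w)) (fun x hx => by simp [hx])
    (fun v hv hv' => by rcases hcases v hv hv' with rfl | rfl | rfl | rfl <;> assumption)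
  rw [hcard] at hcube
  refine ⟨?_, Φ.adj_of_insert ha rfl, Φ.adj_of_insert hba rfl,
    (Φ.adj_of_insert (e := a) (by simp [ha, hab]) (Finset.insert_comm _ _ _)).symm,
    (Φ.adj_of_insert hb rfl).symm⟩
  convert hcube
  ext v
  simp only [Set.mem_insert_iff, Set.mem_singleton_iff, icc, Set.mem_ofPred_eq]
  constructor
  · rintro (rfl | rfl | rfl | rfl)
    · exact ⟨subset_rfl, fun x hx => by simp [hx]⟩
    · exact ⟨fun x hx => by simp [hx], Finset.subset_insert _ _⟩
    · exact ⟨fun x hx => by simp [hx], subset_rfl⟩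
    · refine ⟨fun x hx => by simp [hx], fun x hx => ?_⟩
      simp only [Finset.mem_insert] at hx ⊢
      tauto
  · rintro ⟨hv, hv'⟩
    rcases hcases v.1 hv hv' with h' | h' | h' | h'
    · exact .inl (Subtype.ext h')
    · exact .inr (.inl (Subtype.ext h'))
    · exact .inr (.inr (.inl (Subtype.ext h')))
    · exact .inr (.inr (.inr (Subtype.ext h')))

theorem eq_erase_of_adj {u v : Φ.Vertex} (h : Φ.complex.skel.Adj v u)
    (hc : u.1.card < v.1.card) : ∃ e ∈ v.1, u.1 = v.1.erase e := by
  obtain ⟨e, he⟩ := Φ.adj_iff.1 h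
  have hev : e ∈ v.1 := by
    by_contra hev
    refine absurd (Finset.card_le_card (s := v.1) (t := u.1) fun x hx => ?_) (by omega)
    exact ((he x).2 (fun h => hev (h ▸ hx))).1 hx
  refine ⟨e, hev, ?_⟩
  ext x
  rw [Finset.mem_erase]
  have := he x
  have := he e
  by_cases hx : x = e
  · subst hx; tauto
  · tauto

/-- The rank is the cardinality. Removal of single elements provides lower neighbours, and two of
them span a square with their intersection, a configuration by `inter`. -/
theorem isSimplyConnected : Φ.complex.IsSimplyConnected := by
  refine CubeComplex.isSimplyConnected_of_rank (fun v => v.1.card) ⟨∅, Φ.empty⟩ rfl ?_ ?_ ?_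
  · intro u v h
    by_contra! H
    obtain ⟨e, he⟩ := Φ.adj_iff.1 h
    by_cases heu : e ∈ u.1
    · have hss : v.1 ⊂ u.1 := by
        refine (Finset.ssubset_iff_of_subset fun x hx => ?_).2 ⟨e, heu, by have := he e; tauto⟩
        by_cases hxe : x = e
        · rwa [hxe]
        · exact ((he x).2 hxe).2 hx
      have := Finset.card_lt_card hss
      omega
    · have hss : u.1 ⊂ v.1 := by
        refine (Finset.ssubset_iff_of_subset fun x hx => ?_).2 ⟨e, by have := he e; tauto, heu⟩
        by_cases hxe : x = e
        · exact absurd (hxe ▸ hx) heu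
        · exact ((he x).2 hxe).1 hx
      have := Finset.card_lt_card hss
      omega
  · intro v hv
    have hne : v.1.Nonempty := Finset.nonempty_iff_ne_empty.2 fun h => hv (Subtype.ext h)
    obtain ⟨m, hm, -, hc⟩ := Φ.exists_erase ∅ v.1 Φ.empty v.2 (Finset.empty_ssubset.2 hne)
    refine ⟨⟨v.1.erase m, hc⟩, (Φ.adj_of_insert (e := m) (by simp) ?_).symm,
      Finset.card_erase_lt_of_mem hm⟩
    simp [Finset.insert_erase hm]
  · intro v u w hu hw hcu hcw huw
    obtain ⟨a, ha, hua⟩ := Φ.eq_erase_of_adj hu hcu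
    obtain ⟨b, hb, hwb⟩ := Φ.eq_erase_of_adj hw hcw
    have hab : a ≠ b := by
      rintro rfl
      exact huw (Subtype.ext (hua.trans hwb.symm))
    have hx := Φ.inter u.2 w.2
    obtain ⟨v, hv⟩ := v
    obtain ⟨u, hu'⟩ := u
    obtain ⟨w, hw'⟩ := w
    simp only at *
    have e1 : insert b (u ∩ w) = u := by
      subst hua hwb
      ext x
      simp only [Finset.mem_insert, Finset.mem_inter, Finset.mem_erase]
      by_cases hxb : x = b
      · subst hxb; simp [hb, hab.symm]
      · simp [hxb]
    have e2 : insert a (u ∩ w) = w := by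
      subst hua hwb
      ext x
      simp only [Finset.mem_insert, Finset.mem_inter, Finset.mem_erase]
      by_cases hxa : x = a
      · subst hxa; simp [ha, hab]
      · simp only [hxa]; tauto
    have e3 : insert b (insert a (u ∩ w)) = v := by
      rw [e2, hwb, Finset.insert_erase hb]
    have hb' : b ∉ u ∩ w := by simp [hwb]
    have ha' : a ∉ u ∩ w := by simp [hua]
    have hsq := Φ.isSquare hab ha' hb' hx (by rwa [e2]) (by rwa [e1]) (by rwa [e3])
    refine ⟨⟨u ∩ w, hx⟩, ?_, ?_, ?_⟩
    · rw [e2] at e3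
      simpa only [e1, e2, e3] using hsq.rotate.rotate
    · have := Finset.card_insert_of_notMem hb'
      rw [e1] at this
      exact this ▸ Nat.lt_succ_self _
    · have := Finset.card_insert_of_notMem ha'
      rw [e2] at this
      exact this ▸ Nat.lt_succ_self _

/-- Each neighbour of `v` flips one element, and an edge of the link says that two flips can be done
together. Any two elements involve at most two flips, so `of_pairs` allows all the flips of `S` at
once, in every combination. -/
theorem isFlagLink (v : Φ.Vertex) : Φ.complex.IsFlagLink v := by
  classical
  have hp₀ : ∀ {p r t : Prop}, (p ↔ ¬ r) → ¬ (r ↔ t) → (p ↔ t) := by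
    intros; tauto
  have hp₁ : ∀ {p q r t : Prop}, (p ↔ ¬ r) → (r ↔ q) → ¬ (r ↔ t) →
      ((p ∨ q) ∧ (¬ r ∨ p ∧ q) ↔ t) := by
    intros; tauto
  have hp₂ : ∀ {p q r t : Prop}, (q ↔ ¬ r) → (r ↔ p) → ¬ (r ↔ t) →
      ((p ∨ q) ∧ (¬ r ∨ p ∧ q) ↔ t) := by
    intros; tauto
  intro S hS hadj hpair
  -- `choose!` needs a default element of `E`; without elements there are no neighbours.
  rcases isEmpty_or_nonempty E with hE | hE
  · refine ⟨{v}, Φ.complex.singleton_mem v, rfl, Set.ext fun u => ⟨fun hu => ?_, ?_⟩⟩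
    · exact hE.elim (Φ.adj_iff.1 (hadj u hu)).choose
    · rintro ⟨-, hu⟩
      exact hE.elim (Φ.adj_iff.1 hu).choose
  choose! ε hε using fun u hu => Φ.adj_iff.1 (hadj u hu)
  have hmem : ∀ u ∈ S, (ε u ∈ u.1 ↔ ε u ∉ v.1) := fun u hu => by
    have := hε u hu (ε u)
    tauto
  have huniq : ∀ u ∈ S, ∀ u' : Φ.Vertex, (∀ x, (x ∈ v.1 ↔ x ∈ u'.1) ↔ x ≠ ε u) → u' = u := by
    intro u hu u' h
    refine Subtype.ext (Finset.ext fun x => ?_)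
    have := h x
    have := hε u hu x
    tauto
  let F := hS.toFinset.image ε
  have hF : ∀ x, x ∈ F ↔ ∃ u ∈ S, ε u = x := by simp [F]
  have hconf : ∀ w, v.1 \ F ⊆ w → w ⊆ v.1 ∪ F → Φ.IsConfig w := by
    intro w h1 h2
    have hout : ∀ x, ¬ (x ∈ v.1 ↔ x ∈ w) → ∃ u ∈ S, ε u = x := by
      intro x hx
      rw [← hF]
      have e1 := @h1 x
      have e2 := @h2 x
      simp only [Finset.mem_sdiff, Finset.mem_union] at e1 e2
      tauto
    refine Φ.of_pairs w fun a b => ?_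
    by_cases ha : a ∈ v.1 ↔ a ∈ w <;> by_cases hb : b ∈ v.1 ↔ b ∈ w
    · exact ⟨v.1, v.2, ha, hb⟩
    · obtain ⟨u, hu, rfl⟩ := hout b hb
      have h := (hε u hu a).2 (by rintro rfl; exact hb ha)
      exact ⟨u.1, u.2, h.symm.trans ha, hp₀ (hmem u hu) hb⟩
    · obtain ⟨u, hu, rfl⟩ := hout a ha
      have h := (hε u hu b).2 (by rintro rfl; exact ha hb)
      exact ⟨u.1, u.2, hp₀ (hmem u hu) ha, h.symm.trans hb⟩
    · obtain ⟨u, hu, rfl⟩ := hout a ha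
      obtain ⟨u', hu', rfl⟩ := hout b hb
      by_cases huu : u = u'
      · subst huu
        exact ⟨u.1, u.2, hp₀ (hmem u hu) ha, hp₀ (hmem u hu) ha⟩
      have hne : ε u ≠ ε u' := fun h => huu (huniq u' hu' u fun x => by rw [← h]; exact hε u hu x)
      obtain ⟨c, ⟨s, t, hst, hc, rfl⟩, hv, heq⟩ := hpair u hu u' hu' huu
      have hus : u ∈ ({u, u'} : Set Φ.Vertex) := by simp
      have hus' : u' ∈ ({u, u'} : Set Φ.Vertex) := by simp
      rw [heq] at hus hus'
      have h₁ := hmem u hu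
      have h₂ := hmem u' hu'
      have h₃ := (hε u hu (ε u')).2 hne.symm
      have h₄ := (hε u' hu' (ε u)).2 hne
      -- This set is `v` with both flips carried out: it takes `u ∩ u'` inside `v` and `u ∪ u'`
      -- outside `v`. It lies in the interval of the cube through `v`, `u` and `u'`.
      have hmaj : ∀ x, x ∈ (u.1 ∪ u'.1) \ (v.1 \ (u.1 ∩ u'.1)) ↔
          ((x ∈ u.1 ∨ x ∈ u'.1) ∧ (x ∉ v.1 ∨ x ∈ u.1 ∧ x ∈ u'.1)) := by
        intro x
        rw [Finset.mem_sdiff, Finset.mem_sdiff, Finset.mem_union, Finset.mem_inter, not_and_or, not_not]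
      refine ⟨(u.1 ∪ u'.1) \ (v.1 \ (u.1 ∩ u'.1)), hc _ ?_ ?_, ?_, ?_⟩
      · intro x hx
        rw [hmaj]
        exact ⟨.inl (hus.1.1 hx), .inr ⟨hus.1.1 hx, hus'.1.1 hx⟩⟩
      · intro x hx
        rw [hmaj] at hx
        rcases hx.1 with h | h
        · exact hus.1.2 h
        · exact hus'.1.2 h
      · rw [hmaj]; exact hp₁ h₁ h₄ ha
      · rw [hmaj]; exact hp₂ h₂ h₃ hb
  refine ⟨Φ.icc (v.1 \ F) (v.1 ∪ F), ⟨_, _, ?_, hconf, rfl⟩, ⟨?_, ?_⟩, ?_⟩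
  · exact Finset.sdiff_subset.trans Finset.subset_union_left
  · exact Finset.sdiff_subset
  · exact Finset.subset_union_left
  · ext u
    constructor
    · intro hu
      refine ⟨⟨fun x hx => ?_, fun x hx => ?_⟩, hadj u hu⟩
      · rw [Finset.mem_sdiff, hF] at hx
        exact ((hε u hu x).2 (by rintro rfl; exact hx.2 ⟨u, hu, rfl⟩)).1 hx.1
      · rw [Finset.mem_union, hF]
        by_cases hxu : x = ε u
        · exact .inr ⟨u, hu, hxu.symm⟩
        · exact .inl (((hε u hu x).2 hxu).2 hx)
    · rintro ⟨⟨h1, h2⟩, ha⟩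
      obtain ⟨e, he⟩ := Φ.adj_iff.1 ha
      have heF : e ∈ F := by
        have e1 := @h1 e
        have e2 := @h2 e
        have := he e
        simp only [Finset.mem_sdiff, Finset.mem_union] at e1 e2
        tauto
      obtain ⟨u', hu', rfl⟩ := (hF e).1 heF
      rwa [huniq u' hu' u he]

theorem isCAT0 : Φ.complex.IsCAT0 := ⟨Φ.isSimplyConnected, Φ.isFlagLink⟩

theorem encard_neighborSet_le (v : Φ.Vertex) (A : Finset E)
    (hA : ∀ e, ∀ u : Φ.Vertex, (∀ x, (x ∈ v.1 ↔ x ∈ u.1) ↔ x ≠ e) → e ∈ A) :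
    (Φ.complex.skel.neighborSet v).encard ≤ A.card := by
  have h1 : ∀ u ∈ Φ.complex.skel.neighborSet v, ∃ e, ∀ x, (x ∈ v.1 ↔ x ∈ u.1) ↔ x ≠ e :=
    fun u hu => Φ.adj_iff.1 hu
  by_cases hne : Nonempty E
  · choose! ε hε using h1
    rw [← Set.encard_coe_eq_coe_finsetCard]
    refine Set.encard_le_encard_of_injOn (f := ε) (fun u hu => hA _ u (hε u hu)) ?_
    intro u hu u' hu' h
    refine Subtype.ext (Finset.ext fun x => ?_)
    have h2 := hε u hu x
    have h3 := hε u' hu' x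
    rw [h] at h2
    tauto
  · have : Φ.complex.skel.neighborSet v = ∅ := by
      ext u
      simp only [Set.mem_empty_iff_false, iff_false]
      intro hu
      obtain ⟨e, -⟩ := h1 u hu
      exact hne ⟨e⟩
    simp [this]

/-! ### Hyperplanes of a configuration complex -/

theorem exists_label (e : Φ.complex.skel.edgeSet) : ∃ l, ∀ u v : Φ.Vertex,
    (e : Sym2 Φ.Vertex) = s(u, v) → ∀ x, (x ∈ u.1 ↔ x ∈ v.1) ↔ x ≠ l := by
  obtain ⟨e, he⟩ := e
  induction e using Sym2.ind with
  | _ a b =>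
    obtain ⟨l, hl⟩ := Φ.adj_iff.1 he
    refine ⟨l, fun u v huv x => ?_⟩
    rcases Sym2.eq_iff.1 huv with ⟨rfl, rfl⟩ | ⟨rfl, rfl⟩
    · exact hl x
    · exact iff_comm.trans (hl x)

/-- The element of `E` by which the ends of an edge differ. -/
noncomputable def label (e : Φ.complex.skel.edgeSet) : E := (Φ.exists_label e).choose

theorem label_spec {u v : Φ.Vertex} (h : Φ.complex.skel.Adj u v) (x : E) :
    (x ∈ u.1 ↔ x ∈ v.1) ↔ x ≠ Φ.label ⟨s(u, v), h⟩ :=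
  (Φ.exists_label ⟨s(u, v), h⟩).choose_spec u v rfl x

theorem label_eq {u v : Φ.Vertex} (h : Φ.complex.skel.Adj u v) {a : E} (ha : a ∉ u.1)
    (hv : v.1 = insert a u.1) : Φ.label ⟨s(u, v), h⟩ = a := by
  by_contra hne
  have := (Φ.label_spec h a).2 (Ne.symm hne)
  rw [hv] at this
  simp [ha] at this

/-- Consecutive sides flip different elements, since `a ≠ c`. If `ab` and `dc` flipped different
elements, `ad` would have to flip the same one as `ab`, contradicting `b ≠ d`. -/
theorem label_eq_of_isSquare {a b c d : Φ.Vertex} (h : Φ.complex.IsSquare a b c d) :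
    Φ.label ⟨s(a, b), h.ab⟩ = Φ.label ⟨s(d, c), h.cd.symm⟩ := by
  have h1 := Φ.label_spec h.ab
  have h2 := Φ.label_spec h.bc
  have h3 := Φ.label_spec h.cd.symm
  have h4 := Φ.label_spec h.da.symm
  have hac : a.1 ≠ c.1 := fun H => h.ne_ac (Subtype.ext H)
  have hbd : b.1 ≠ d.1 := fun H => h.ne_bd (Subtype.ext H)
  generalize Φ.label ⟨s(a, b), h.ab⟩ = i at *
  generalize Φ.label ⟨s(b, c), h.bc⟩ = j at *
  generalize Φ.label ⟨s(d, c), h.cd.symm⟩ = k at *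
  generalize Φ.label ⟨s(a, d), h.da.symm⟩ = l at *
  have hij : i ≠ j := by
    rintro rfl
    refine hac (Finset.ext fun x => ?_)
    have := h1 x
    have := h2 x
    tauto
  by_contra hik
  have hil : i = l := by
    by_contra hil
    have := h1 i
    have := (h2 i).2 hij
    have := (h3 i).2 hik
    have := (h4 i).2 hil
    tauto
  subst hil
  refine hbd (Finset.ext fun x => ?_)
  have := h1 x
  have := h4 x
  tauto

/-- Descend from `s` to `u` by removing one element at a time; each removal crosses a square with
opposite edges labelled `a`. -/
theorem dualHyperplane_eq {a : E} : ∀ (n : ℕ) {u s u' s' : Φ.Vertex} (_ : u.1 ⊆ s.1)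
    (_ : (s.1 \ u.1).card ≤ n) (_ : a ∉ s.1) (_ : u'.1 = insert a u.1) (_ : s'.1 = insert a s.1)
    (h : Φ.complex.skel.Adj u u') (h' : Φ.complex.skel.Adj s s'),
    Φ.complex.dualHyperplane ⟨s(u, u'), h⟩ = Φ.complex.dualHyperplane ⟨s(s, s'), h'⟩ := by
  intro n
  induction n with
  | zero =>
    intro u s u' s' hus hn ha hu' hs' h h'
    have hsu : s.1 ⊆ u.1 := by
      rwa [Nat.le_zero, Finset.card_eq_zero, Finset.sdiff_eq_empty_iff_subset] at hn
    obtain rfl : u = s := Subtype.ext (subset_antisymm hus hsu)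
    obtain rfl : u' = s' := Subtype.ext (hu'.trans hs'.symm)
    rfl
  | succ n ih =>
    intro u s u' s' hus hn ha hu' hs' h h'
    by_cases hsu : s.1 ⊆ u.1
    · obtain rfl : u = s := Subtype.ext (subset_antisymm hus hsu)
      obtain rfl : u' = s' := Subtype.ext (hu'.trans hs'.symm)
      rfl
    obtain ⟨m, hm, hmu, hc⟩ := Φ.exists_erase u.1 s.1 u.2 s.2 ⟨hus, hsu⟩
    have ham : a ≠ m := fun h => ha (h ▸ hm)
    -- This set is the majority of `s'`, `s.erase m` and `u'`.
    have hc' : Φ.IsConfig (insert a (s.1.erase m)) := by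
      refine Φ.of_pairs _ fun x y => ?_
      by_cases h1 : x ≠ m ∧ y ≠ m
      · exact ⟨s'.1, s'.2, by simp [hs', h1.1], by simp [hs', h1.2]⟩
      by_cases h2 : x ≠ a ∧ y ≠ a
      · exact ⟨_, hc, by simp [h2.1], by simp [h2.2]⟩
      refine ⟨u'.1, u'.2, ?_⟩
      have h3 : a ∈ u'.1 := by simp [hu']
      have h4 : m ∉ u'.1 := by simp [hu', hmu, ham.symm]
      have h5 : a ∈ insert a (s.1.erase m) := by simp
      have h6 : m ∉ insert a (s.1.erase m) := by simp [ham.symm]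
      by_cases hxa : x = a
      · by_cases hya : y = a
        · subst hxa hya
          exact ⟨by tauto, by tauto⟩
        · obtain rfl : y = m := by
            by_contra; exact h1 ⟨hxa ▸ ham, ‹_›⟩
          subst hxa
          exact ⟨by tauto, by tauto⟩
      · obtain rfl : y = a := by
          by_contra; exact h2 ⟨hxa, ‹_›⟩
        obtain rfl : x = m := by
          by_contra; exact h1 ⟨‹_›, ham⟩
        exact ⟨by tauto, by tauto⟩
    have hae : a ∉ s.1.erase m := fun h => ha (Finset.mem_of_mem_erase h)
    have hme : m ∉ s.1.erase m := Finset.notMem_erase _ _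
    have i1 : insert m (s.1.erase m) = s.1 := Finset.insert_erase hm
    have i2 : insert m (insert a (s.1.erase m)) = s'.1 := by
      rw [Finset.insert_comm, i1, hs']
    have hsq := Φ.isSquare ham hae hme hc hc' (i1.symm ▸ s.2) (i2.symm ▸ s'.2)
    simp only [i1, i2] at hsq
    refine (ih (u := u) (s := ⟨_, hc⟩) (u' := u') (s' := ⟨_, hc'⟩) ?_ ?_ hae hu' rfl h
      hsq.ab).trans (Quot.sound ⟨_, _, _, _, hsq, rfl, rfl⟩)
    · exact fun x hx => Finset.mem_erase.2 ⟨fun h => hmu (h ▸ hx), hus hx⟩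
    · have : (s.1.erase m \ u.1) = (s.1 \ u.1).erase m := by
        ext x; simp only [Finset.mem_sdiff, Finset.mem_erase]; tauto
      simp only
      rw [this, Finset.card_erase_of_mem (by simp [hm, hmu])]
      omega

/-- Both edges are parallel to the edge labelled `a` at the intersection of their lower ends. -/
theorem dualHyperplane_eq_of_insert {a : E} {u s u' s' : Φ.Vertex} (hu : a ∉ u.1) (hs : a ∉ s.1)
    (hu' : u'.1 = insert a u.1) (hs' : s'.1 = insert a s.1)
    (h : Φ.complex.skel.Adj u u') (h' : Φ.complex.skel.Adj s s') :
    Φ.complex.dualHyperplane ⟨s(u, u'), h⟩ = Φ.complex.dualHyperplane ⟨s(s, s'), h'⟩ := by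
  let t : Φ.Vertex := ⟨u.1 ∩ s.1, Φ.inter u.2 s.2⟩
  let t' : Φ.Vertex := ⟨u'.1 ∩ s'.1, Φ.inter u'.2 s'.2⟩
  have ht : t'.1 = insert a t.1 := by
    simp only [t, t', hu', hs', Finset.insert_inter_distrib]
  have hadj : Φ.complex.skel.Adj t t' := Φ.adj_of_insert (e := a) (by simp [t, hu]) ht
  exact (Φ.dualHyperplane_eq _ Finset.inter_subset_left le_rfl hu ht hu' hadj h).symm.trans
    (Φ.dualHyperplane_eq _ Finset.inter_subset_right le_rfl hs ht hs' hadj h')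

/-- A colouring of the crossing graph colours the elements of `E` in such a way that two elements
that can be added independently to a configuration get distinct colours. -/
theorem exists_coloring {C : Type*} [Nonempty C] (c : Φ.complex.crossingGraph.Coloring C) :
    ∃ γ : E → C, ∀ a b w, a ≠ b → a ∉ w → b ∉ w → Φ.IsConfig w → Φ.IsConfig (insert a w) →
      Φ.IsConfig (insert b w) → Φ.IsConfig (insert b (insert a w)) → γ a ≠ γ b := by
  have hex : ∀ a : E, ∃ k : C, ∀ (u u' : Φ.Vertex) (_ : a ∉ u.1) (_ : u'.1 = insert a u.1)
      (h : Φ.complex.skel.Adj u u'), c (Φ.complex.dualHyperplane ⟨s(u, u'), h⟩) = k := by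
    intro a
    by_cases H : ∃ u u' : Φ.Vertex, a ∉ u.1 ∧ u'.1 = insert a u.1
    · obtain ⟨u, u', hu, hu'⟩ := H
      exact ⟨c (Φ.complex.dualHyperplane ⟨s(u, u'), Φ.adj_of_insert hu hu'⟩), fun s s' hs hs' h =>
        congrArg c (Φ.dualHyperplane_eq_of_insert hs hu hs' hu' _ _)⟩
    · exact ⟨Classical.arbitrary C, fun u u' hu hu' => absurd ⟨u, u', hu, hu'⟩ H⟩
  choose γ hγ using hex
  refine ⟨γ, fun a b w hab ha hb h h1 h2 h12 => ?_⟩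
  have hsq := Φ.isSquare hab ha hb h h1 h2 h12
  have hba : b ∉ insert a w := by simp [hb, hab.symm]
  rw [← hγ a ⟨w, h⟩ ⟨insert a w, h1⟩ ha rfl hsq.ab,
    ← hγ b ⟨insert a w, h1⟩ ⟨insert b (insert a w), h12⟩ hba rfl hsq.bc]
  refine c.valid ⟨fun heq => hab ?_, _, _, _, _, hsq, rfl, rfl⟩
  -- Crossing requires distinct hyperplanes. The label is constant on a hyperplane, so `a ≠ b`
  -- suffices.
  have hlift : ∀ e f, Φ.complex.Opposite e f → Φ.label e = Φ.label f := by
    rintro ⟨e, he⟩ ⟨f, hf⟩ ⟨a, b, c, d, h, rfl, rfl⟩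
    exact Φ.label_eq_of_isSquare h
  have := congrArg (Quot.lift Φ.label hlift) heq
  simp only [CubeComplex.dualHyperplane] at this
  rwa [Φ.label_eq hsq.ab ha rfl, Φ.label_eq hsq.bc hba rfl] at this

end ConfigFamily

/-! ### Boxes in path times tree, and their events -/

/-- A box in the product of the path `ℕ` and the binary tree of words, ordered by prefixes: the
product of the interval `[left, right)` and of the subtree of the words that extend `top` but no
word of `cut`. -/
structure Box where
  left : ℕ
  right : ℕ
  top : List Bool
  cut : Set (List Bool)

/-- The point `(x, t)` lies in the box. -/
def Box.Mem (β : Box) (x : ℕ) (t : List Bool) : Prop :=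
  β.left ≤ x ∧ x < β.right ∧ β.top <+: t ∧ ∀ c ∈ β.cut, ¬ c <+: t

/-- The events attached to a family of boxes: reaching a point of the path, reaching a node of the
tree, and entering a box. -/
inductive Event (ι : Type) : Type
  | step : ℕ → Event ι
  | node : List Bool → Event ι
  | box : ι → Event ι

namespace Event

variable {ι : Type}

noncomputable instance : DecidableEq (Event ι) := Classical.decEq _

/-- `Req β a b` means that `a` can occur only after `b`. -/
inductive Req (β : ι → Box) : Event ι → Event ι → Prop
  | step {m n : ℕ} : m < n → Req β (step n) (step m)
  | node {w w' : List Bool} : w' <+: w → w' ≠ w → Req β (node w) (node w')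
  | boxStep (i : ι) : Req β (box i) (step (β i).left)
  | boxNode (i : ι) : Req β (box i) (node (β i).top)

/-- `Conf β N a b` means that `a` and `b` cannot both occur. The points and the nodes beyond the
bound `N` do not occur. -/
inductive Conf (β : ι → Box) (N : ℕ∞) : Event ι → Event ι → Prop
  | node {w w' : List Bool} : ¬ w <+: w' → ¬ w' <+: w → Conf β N (node w) (node w')
  | boxStep {i : ι} {n : ℕ} : (β i).right ≤ n → Conf β N (box i) (step n)
  | boxNode {i : ι} {c w : List Bool} : c ∈ (β i).cut → c <+: w → Conf β N (box i) (node w)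
  | stepBound {n : ℕ} : ¬ (n : ℕ∞) ≤ N → Conf β N (step n) (step n)
  | nodeBound {w : List Bool} : ¬ (w.length : ℕ∞) ≤ N → Conf β N (node w) (node w)

/-- The height of an event. -/
def height : Event ι → ℕ∞
  | step n => n
  | node w => w.length
  | box _ => ⊤

theorem Req.height_lt {β : ι → Box} {a b : Event ι} (h : Req β a b) : b.height < a.height := by
  cases h with
  | step h => simpa [height] using h
  | @node w w' h h' =>
    simp only [height, Nat.cast_lt]
    exact lt_of_le_of_ne h.length_le fun H => h' (h.eq_of_length H)
  | boxStep i => exact ENat.natCast_lt_top _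
  | boxNode i => exact ENat.natCast_lt_top _

/-- The configurations of the events of a family of boxes. -/
noncomputable def configs (β : ι → Box) (N : ℕ∞) : ConfigFamily (Event ι) where
  IsConfig s := (∀ a ∈ s, ∀ b, Req β a b → b ∈ s) ∧ ∀ a ∈ s, ∀ b ∈ s, ¬ Conf β N a b
  empty := by simp
  of_pairs w h := by
    refine ⟨fun a ha b hab => ?_, fun a ha b hb hab => ?_⟩
    · obtain ⟨w', h', h1, h2⟩ := h a b
      exact h2.1 (h'.1 a (h1.2 ha) b hab)
    · obtain ⟨w', h', h1, h2⟩ := h a b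
      exact h'.2 a (h1.2 ha) b (h2.2 hb) hab
  exists_erase u s hu hs hus := by
    -- An event of greatest height outside `u` is required by nothing in `s`: an event requiring it
    -- would be higher, and one in `u` would force it into `u`.
    obtain ⟨m, hm, hmax⟩ := Finset.exists_max_image (s \ u) height
      (Finset.sdiff_nonempty.2 hus.2)
    rw [Finset.mem_sdiff] at hm
    refine ⟨m, hm.1, hm.2, fun a ha b hab => ?_, fun a ha b hb => ?_⟩
    · rw [Finset.mem_erase] at ha ⊢
      refine ⟨?_, hs.1 a ha.2 b hab⟩
      rintro rfl
      have hau : a ∉ u := fun H => hm.2 (hu.1 a H _ hab)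
      exact absurd hab.height_lt (not_lt.2 (hmax a (Finset.mem_sdiff.2 ⟨ha.2, hau⟩)))
    · exact hs.2 a (Finset.mem_of_mem_erase ha) b (Finset.mem_of_mem_erase hb)

variable {β : ι → Box} {N : ℕ∞} {s : Finset (Event ι)}

theorem exists_step_iff (hs : (configs β N).IsConfig s) {m : ℕ} (hm : step m ∈ s) :
    ∃ x, ∀ n, step n ∈ s ↔ n ≤ x := by
  have hfin : {n | step n ∈ s}.Finite :=
    s.finite_toSet.preimage (f := step) (fun a _ b _ h => Event.step.inj h)
  obtain ⟨x, hx, hmax⟩ := Set.exists_max_image _ id hfin ⟨m, hm⟩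
  refine ⟨x, fun n => ⟨fun h => hmax n h, fun h => ?_⟩⟩
  rcases h.eq_or_lt with rfl | h
  · exact hx
  · exact hs.1 _ hx _ (.step h)

/-- Incomparable nodes conflict and prefixes are required, so the nodes present are the prefixes of
the longest one. -/
theorem exists_node_iff (hs : (configs β N).IsConfig s) {w : List Bool} (hw : node w ∈ s) :
    ∃ t, ∀ w, node w ∈ s ↔ w <+: t := by
  have hfin : {w | node w ∈ s}.Finite :=
    s.finite_toSet.preimage (f := node) (fun a _ b _ h => Event.node.inj h)
  obtain ⟨t, ht, hmax⟩ := Set.exists_max_image _ List.length hfin ⟨w, hw⟩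
  refine ⟨t, fun n => ⟨fun h => ?_, fun h => ?_⟩⟩
  · by_contra hn
    have hn' : ¬ t <+: n := fun H => hn (H.eq_of_length_le (hmax n h) ▸ List.prefix_rfl)
    exact hs.2 _ h _ ht (.node hn hn')
  · by_cases hnt : n = t
    · exact hnt ▸ ht
    · exact hs.1 _ ht _ (.node h hnt)

/-- The boxes that occur in a configuration, or may be added to it, share a point. -/
theorem exists_mem_of_box (hs : (configs β N).IsConfig s) {i : ι} (hi : box i ∈ s) :
    ∃ x t, (∀ n, step n ∈ s ↔ n ≤ x) ∧ (∀ w, node w ∈ s ↔ w <+: t) ∧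
      ∀ j, (configs β N).IsConfig (insert (box j) s) → (β j).Mem x t := by
  obtain ⟨x, hx⟩ := exists_step_iff hs (hs.1 _ hi _ (.boxStep i))
  obtain ⟨t, ht⟩ := exists_node_iff hs (hs.1 _ hi _ (.boxNode i))
  refine ⟨x, t, hx, ht, fun j hj => ⟨?_, ?_, ?_, ?_⟩⟩
  · have := hj.1 (box j) (by simp) _ (.boxStep j)
    rwa [Finset.mem_insert, or_iff_right (by simp), hx] at this
  · by_contra H
    exact hj.2 (box j) (by simp) (step x) (by simp [hx]) (.boxStep (by omega))
  · have := hj.1 (box j) (by simp) _ (.boxNode j)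
    rwa [Finset.mem_insert, or_iff_right (by simp), ht] at this
  · intro c hc hct
    exact hj.2 (box j) (by simp) (node t) (by simp [ht]) (.boxNode hc hct)

/-- The configuration that consists of the way to the point `(x, t)` and of the boxes in `J`. -/
noncomputable def point (x : ℕ) (t : List Bool) (J : Finset ι) : Finset (Event ι) :=
  (Finset.range (x + 1)).image step ∪ t.inits.toFinset.image node ∪ J.image box

@[simp] theorem step_mem_point {x : ℕ} {t : List Bool} {J : Finset ι} {n : ℕ} :
    step n ∈ point x t J ↔ n ≤ x := by simp [point]

@[simp] theorem node_mem_point {x : ℕ} {t : List Bool} {J : Finset ι} {w : List Bool} :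
    node w ∈ point x t J ↔ w <+: t := by simp [point]

@[simp] theorem box_mem_point {x : ℕ} {t : List Bool} {J : Finset ι} {i : ι} :
    box i ∈ point x t J ↔ i ∈ J := by simp [point]

theorem isConfig_point {x : ℕ} {t : List Bool} {J : Finset ι} (hx : (x : ℕ∞) ≤ N)
    (ht : (t.length : ℕ∞) ≤ N) (hJ : ∀ i ∈ J, (β i).Mem x t) :
    (configs β N).IsConfig (point x t J) := by
  refine ⟨?_, ?_⟩
  · rintro a ha b (h | ⟨h, -⟩ | i | i)
    · rw [step_mem_point] at *; omega
    · rw [node_mem_point] at *; exact h.trans ha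
    · rw [box_mem_point] at ha; rw [step_mem_point]; exact (hJ i ha).1
    · rw [box_mem_point] at ha; rw [node_mem_point]; exact (hJ i ha).2.2.1
  · rintro a ha b hb (⟨h, h'⟩ | h | ⟨h, h'⟩ | h | h)
    · rw [node_mem_point] at *
      rcases List.prefix_or_prefix_of_prefix ha hb with H | H
      · exact h H
      · exact h' H
    · rw [box_mem_point] at ha; rw [step_mem_point] at hb
      have := (hJ _ ha).2.1
      omega
    · rw [box_mem_point] at ha; rw [node_mem_point] at hb
      exact (hJ _ ha).2.2.2 _ h (h'.trans hb)
    · rw [step_mem_point] at ha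
      exact h (le_trans (by exact_mod_cast ha) hx)
    · rw [node_mem_point] at ha
      exact h (le_trans (by exact_mod_cast ha.length_le) ht)

theorem insert_box_point {x : ℕ} {t : List Bool} {J : Finset ι} [DecidableEq ι] {i : ι} :
    insert (box i) (point x t J) = point x t (insert i J) := by
  ext (n | w | j) <;> simp

/-- Boxes that share a point get distinct colours. -/
theorem exists_coloring {C : Type*} [Nonempty C]
    (c : (configs β N).complex.crossingGraph.Coloring C) :
    ∃ γ : ι → C, ∀ (i j : ι) (x : ℕ) (t : List Bool), i ≠ j → (x : ℕ∞) ≤ N → (t.length : ℕ∞) ≤ N → (β i).Mem x t →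
      (β j).Mem x t → γ i ≠ γ j := by
  classical
  obtain ⟨γ, hγ⟩ := (configs β N).exists_coloring c
  refine ⟨fun i => γ (box i), fun i j x t hij hx ht hi hj =>
    hγ _ _ (point x t ∅) (by simpa using hij) (by simp) (by simp)
      (isConfig_point hx ht (by simp)) ?_ ?_ ?_⟩
  all_goals
    simp only [insert_box_point]
    exact isConfig_point hx ht (by simp [hi, hj])

/-! ### Degree and dimension bounds -/

/-- Two sets that differ exactly by `e`: one is the other with `e` added. -/
theorem eq_insert_or_of_flip {s u : Finset (Event ι)} {e : Event ι}
    (h : ∀ x, (x ∈ s ↔ x ∈ u) ↔ x ≠ e) : (e ∉ s ∧ u = insert e s) ∨ (e ∉ u ∧ s = insert e u) := by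
  have he := h e
  by_cases hes : e ∈ s
  · refine .inr ⟨by tauto, Finset.ext fun x => ?_⟩
    have := h x
    by_cases hx : x = e
    · subst hx; simp [hes]
    · simp only [Finset.mem_insert, hx, false_or]; tauto
  · refine .inl ⟨hes, Finset.ext fun x => ?_⟩
    have := h x
    by_cases hx : x = e
    · subst hx; simp only [Finset.mem_insert, true_or, iff_true]; tauto
    · simp only [Finset.mem_insert, hx, false_or]; tauto

/-- If at most three boxes share a point, then the complex has degree at most nine. -/
theorem encard_neighborSet_le (hβ : ∀ x t, {i | (β i).Mem x t}.encard ≤ 3)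
    (v : (configs β N).Vertex) : ((configs β N).complex.skel.neighborSet v).encard ≤ 9 := by
  classical
  obtain ⟨s, hs⟩ := v
  -- Only the last step can be undone and only the next one added.
  have hstep : ∃ A : Finset ℕ, A.card ≤ 2 ∧ ∀ n, ∀ u : (configs β N).Vertex,
      (∀ x, (x ∈ s ↔ x ∈ u.1) ↔ x ≠ step n) → n ∈ A := by
    have hlt : ∀ n m, n < m → ∀ u : (configs β N).Vertex,
        (∀ x, (x ∈ s ↔ x ∈ u.1) ↔ x ≠ step n) → step m ∉ s := by
      intro n m hnm u hu hms
      have h1 := hs.1 _ hms _ (.step hnm)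
      have h2 := u.2.1 _ (((hu (step m)).2 (by simp [hnm.ne'])).1 hms) _ (.step hnm)
      exact (hu (step n)).1 (by simp [h1, h2]) rfl
    have hgt : ∀ n m, n < m → ∀ u : (configs β N).Vertex,
        (∀ x, (x ∈ s ↔ x ∈ u.1) ↔ x ≠ step m) → step m ∉ s → step n ∈ s := by
      intro n m hnm u hu hms
      have h1 : step m ∈ u.1 := by have := hu (step m); tauto
      exact ((hu (step n)).2 (by simp [hnm.ne])).2 (u.2.1 _ h1 _ (.step hnm))
    by_cases h0 : ∃ m, step m ∈ s
    · obtain ⟨m, hm⟩ := h0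
      obtain ⟨x, hx⟩ := exists_step_iff hs hm
      refine ⟨{x, x + 1}, Finset.card_le_two, fun n u hu => ?_⟩
      have h1 := hlt n
      have h2 := fun a h => hgt a n h u hu
      rw [Finset.mem_insert, Finset.mem_singleton]
      rcases lt_trichotomy n x with h | h | h
      · exact absurd ((hx x).2 le_rfl) (h1 x h u hu)
      · exact .inl h
      · right
        by_contra hne
        have := (hx _).1 (h2 (x + 1) (by omega) (by rw [hx]; omega))
        omega
    · push Not at h0
      refine ⟨{0}, by simp, fun n u hu => ?_⟩
      rw [Finset.mem_singleton]
      by_contra hn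
      exact h0 0 (hgt 0 n (by omega) u hu (h0 n))
  -- Only the last node and its two children can be flipped; `[]` is slack that shortens the case
  -- analysis.
  have hnode : ∃ A : Finset (List Bool), A.card ≤ 4 ∧ ∀ n, ∀ u : (configs β N).Vertex,
      (∀ x, (x ∈ s ↔ x ∈ u.1) ↔ x ≠ node n) → n ∈ A := by
    have hgt : ∀ n m, n <+: m → n ≠ m → ∀ u : (configs β N).Vertex,
        (∀ x, (x ∈ s ↔ x ∈ u.1) ↔ x ≠ node m) → node m ∉ s → node n ∈ s := by
      intro n m hnm hne u hu hms
      have h1 : node m ∈ u.1 := by have := hu (node m); tauto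
      exact ((hu (node n)).2 (by simp [hne])).2 (u.2.1 _ h1 _ (.node hnm hne))
    by_cases h0 : ∃ m, node m ∈ s
    · obtain ⟨m, hm⟩ := h0
      obtain ⟨t, ht⟩ := exists_node_iff hs hm
      refine ⟨{[], t, t ++ [true], t ++ [false]}, Finset.card_le_four, fun n u hu => ?_⟩
      have hts : node t ∈ s := (ht t).2 List.prefix_rfl
      by_cases hnt : n = t
      · simp [hnt]
      have htu : node t ∈ u.1 := ((hu (node t)).2 (by simpa using Ne.symm hnt)).1 hts
      by_cases hns : node n ∈ s
      · have h1 := u.2.1 _ htu _ (.node ((ht n).1 hns) hnt)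
        exact absurd rfl ((hu (node n)).1 (by simp [hns, h1]))
      · have h1 : node n ∈ u.1 := by have := hu (node n); tauto
        have htn : t <+: n := by
          by_contra H
          exact u.2.2 _ htu _ h1 (.node H fun H' => hns ((ht n).2 H'))
        rcases List.eq_nil_or_concat n with rfl | ⟨n', b, rfl⟩
        · simp
        · have h2 := (ht _).1 (hgt n' _ ⟨[b], by simp⟩ (by simp) u hu hns)
          have h3 : n' = t := h2.eq_of_length_le (by
            have h4 := htn.length_le
            have h5 : t.length ≠ (n'.concat b).length := fun H => hnt (htn.eq_of_length H).symm
            simp at h4 h5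
            omega)
          subst h3
          cases b <;> simp
    · push Not at h0
      refine ⟨{[]}, by simp, fun n u hu => ?_⟩
      rw [Finset.mem_singleton]
      by_contra hn
      exact h0 [] (hgt [] n (by simp) (Ne.symm hn) u hu (h0 n))
  -- Flipping a box leaves the point `(x, t)` unchanged, so every box that can be flipped contains
  -- it.
  have hbox : ∃ A : Finset ι, A.card ≤ 3 ∧ ∀ n, ∀ u : (configs β N).Vertex,
      (∀ x, (x ∈ s ↔ x ∈ u.1) ↔ x ≠ box n) → n ∈ A := by
    by_cases h0 : ∃ i, ∃ u : (configs β N).Vertex, (∀ x, (x ∈ s ↔ x ∈ u.1) ↔ x ≠ box i)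
    · obtain ⟨i, u, hu⟩ := h0
      have hr : ∀ j, ∀ u' : (configs β N).Vertex, (∀ x, (x ∈ s ↔ x ∈ u'.1) ↔ x ≠ box j) →
          (configs β N).IsConfig (insert (box j) s) := by
        intro j u' hu'
        rcases eq_insert_or_of_flip hu' with ⟨h1, h2⟩ | ⟨h1, h2⟩
        · exact h2 ▸ u'.2
        · rwa [Finset.insert_eq_of_mem (by simp [h2])]
      have hi := hr i u hu
      obtain ⟨x, t, hx, ht, -⟩ := exists_mem_of_box hi (Finset.mem_insert_self _ _)
      have hmem : ∀ j, (configs β N).IsConfig (insert (box j) s) → (β j).Mem x t := by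
        intro j hj
        obtain ⟨x', t', hx', ht', h⟩ := exists_mem_of_box hj (Finset.mem_insert_self _ _)
        have h1 : x' = x := by
          refine le_antisymm ?_ ?_
          · have := (hx' x').2 le_rfl
            simp only [Finset.mem_insert, reduceCtorEq, false_or] at this
            rw [← hx]; simpa using this
          · have := (hx x).2 le_rfl
            simp only [Finset.mem_insert, reduceCtorEq, false_or] at this
            rw [← hx']; simpa using this
        have h2 : t' = t := by
          have e1 : t' <+: t := by
            have := (ht' t').2 List.prefix_rfl
            simp only [Finset.mem_insert, reduceCtorEq, false_or] at this
            rw [← ht]; simpa using this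
          have e2 : t <+: t' := by
            have := (ht t).2 List.prefix_rfl
            simp only [Finset.mem_insert, reduceCtorEq, false_or] at this
            rw [← ht']; simpa using this
          exact e1.eq_of_length_le e2.length_le
        rw [← h1, ← h2]
        exact h j (by simpa using hj)
      have hfin : {i | (β i).Mem x t}.Finite :=
        Set.finite_of_encard_le_coe (k := 3) (by exact_mod_cast hβ x t)
      refine ⟨hfin.toFinset, ?_, fun j u' hu' => ?_⟩
      · have := hβ x t
        rw [hfin.encard_eq_coe_toFinset_card] at this
        exact_mod_cast this
      · simpa using hmem j (hr j u' hu')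
    · push Not at h0
      refine ⟨∅, by simp, fun n u hu => ?_⟩
      obtain ⟨x, hx⟩ := h0 n u
      exact absurd (hu x) (by tauto)
  obtain ⟨A, hA, hA'⟩ := hstep
  obtain ⟨B, hB, hB'⟩ := hnode
  obtain ⟨C, hC, hC'⟩ := hbox
  refine ((configs β N).encard_neighborSet_le ⟨s, hs⟩
    (A.image step ∪ B.image node ∪ C.image box) ?_).trans ?_
  · rintro (n | w | i) u hu
    · simpa using hA' n u hu
    · simpa using hB' w u hu
    · simpa using hC' i u hu
  · have h1 := Finset.card_union_le (A.image step ∪ B.image node) (C.image (box (ι := ι)))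
    have h2 := Finset.card_union_le (A.image (step (ι := ι))) (B.image node)
    have h3 := Finset.card_image_le (s := A) (f := step (ι := ι))
    have h4 := Finset.card_image_le (s := B) (f := node (ι := ι))
    have h5 := Finset.card_image_le (s := C) (f := box)
    have : (A.image step ∪ B.image node ∪ C.image box).card ≤ 9 := by omega
    exact_mod_cast this

/-- If at most three boxes share a point, then the complex has dimension at most five. -/
theorem le_five_of_isCube (hβ : ∀ x t, {i | (β i).Mem x t}.encard ≤ 3) {d : ℕ}
    {c : Set (configs β N).Vertex} (hc : (configs β N).complex.IsCube d c) : d ≤ 5 := by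
  classical
  obtain ⟨s, u, hsu, h, rfl⟩ := (configs β N).exists_of_isCube hc
  have hu := h u hsu subset_rfl
  -- Two new events of a cube can occur independently, so neither requires the other. This leaves at
  -- most one step and, as incomparable nodes conflict, at most one node.
  have hstep : ∀ n m, step n ∈ u \ s → step m ∈ u \ s → ¬ n < m := by
    intro n m hn hm hnm
    rw [Finset.mem_sdiff] at hn hm
    have := (h (insert (step m) s) (Finset.subset_insert _ _)
      (Finset.insert_subset hm.1 hsu)).1 (step m) (by simp) _ (.step hnm)
    rw [Finset.mem_insert] at this
    rcases this with H | H
    · exact hnm.ne (Event.step.inj H)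
    · exact hn.2 H
  have hnode : ∀ n m, node n ∈ u \ s → node m ∈ u \ s → n <+: m → n = m := by
    intro n m hn hm hnm
    rw [Finset.mem_sdiff] at hn hm
    by_contra hne
    have := (h (insert (node m) s) (Finset.subset_insert _ _)
      (Finset.insert_subset hm.1 hsu)).1 (node m) (by simp) _ (.node hnm hne)
    rw [Finset.mem_insert] at this
    rcases this with H | H
    · exact hne (Event.node.inj H)
    · exact hn.2 H
  have hA : ∃ A : Finset ℕ, A.card ≤ 1 ∧ ∀ n, step n ∈ u \ s → n ∈ A := by
    by_cases h0 : ∃ n, step n ∈ u \ s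
    · obtain ⟨n, hn⟩ := h0
      refine ⟨{n}, by simp, fun m hm => Finset.mem_singleton.2 ?_⟩
      exact le_antisymm (not_lt.1 (hstep n m hn hm)) (not_lt.1 (hstep m n hm hn))
    · push Not at h0
      exact ⟨∅, by simp, fun n hn => absurd hn (h0 n)⟩
  have hB : ∃ A : Finset (List Bool), A.card ≤ 1 ∧ ∀ n, node n ∈ u \ s → n ∈ A := by
    by_cases h0 : ∃ n, node n ∈ u \ s
    · obtain ⟨n, hn⟩ := h0
      refine ⟨{n}, by simp, fun m hm => Finset.mem_singleton.2 ?_⟩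
      by_contra hne
      exact hu.2 _ (Finset.mem_sdiff.1 hn).1 _ (Finset.mem_sdiff.1 hm).1
        (.node (fun H => hne (hnode n m hn hm H).symm) (fun H => hne (hnode m n hm hn H)))
    · push Not at h0
      exact ⟨∅, by simp, fun n hn => absurd hn (h0 n)⟩
  have hC : ∃ A : Finset ι, A.card ≤ 3 ∧ ∀ n, box n ∈ u \ s → n ∈ A := by
    by_cases h0 : ∃ n, box n ∈ u \ s
    · obtain ⟨n, hn⟩ := h0
      obtain ⟨x, t, -, -, hmem⟩ := exists_mem_of_box hu (Finset.mem_sdiff.1 hn).1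
      have hfin : {i | (β i).Mem x t}.Finite :=
        Set.finite_of_encard_le_coe (k := 3) (by exact_mod_cast hβ x t)
      refine ⟨hfin.toFinset, ?_, fun j hj => ?_⟩
      · have := hβ x t
        rw [hfin.encard_eq_coe_toFinset_card] at this
        exact_mod_cast this
      · have := hmem j (by rwa [Finset.insert_eq_of_mem (Finset.mem_sdiff.1 hj).1])
        simpa using this
    · push Not at h0
      exact ⟨∅, by simp, fun n hn => absurd hn (h0 n)⟩
  obtain ⟨A, hA, hA'⟩ := hA
  obtain ⟨B, hB, hB'⟩ := hB
  obtain ⟨C, hC, hC'⟩ := hC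
  have hsub : u \ s ⊆ A.image step ∪ B.image node ∪ C.image box := by
    rintro (n | w | i) he
    · simpa using hA' n he
    · simpa using hB' w he
    · simpa using hC' i he
  have h0 := Finset.card_le_card hsub
  have h1 := Finset.card_union_le (A.image step ∪ B.image node) (C.image (box (ι := ι)))
  have h2 := Finset.card_union_le (A.image (step (ι := ι))) (B.image node)
  have h3 := Finset.card_image_le (s := A) (f := step (ι := ι))
  have h4 := Finset.card_image_le (s := B) (f := node (ι := ι))
  have h5 := Finset.card_image_le (s := C) (f := box)
  omega

/-- One step, one descent in the tree and the boxes of `J` are independent: their other requirements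
hold at `(x, t)`, and nothing conflicts at the far corner. -/
theorem exists_isCube {x : ℕ} {t : List Bool} {J : Finset ι} (h0 : ∀ i ∈ J, (β i).Mem x t)
    (h1 : ∀ i ∈ J, (β i).Mem (x + 1) (t ++ [true])) :
    ∃ c, (configs β ⊤).complex.IsCube (J.card + 2) c := by
  classical
  have hu : (configs β ⊤).IsConfig (point (x + 1) (t ++ [true]) J) :=
    isConfig_point le_top le_top h1
  have hs : (configs β ⊤).IsConfig (point x t ∅) := isConfig_point le_top le_top (by simp)
  have hsu : point x t ∅ ⊆ point (x + 1) (t ++ [true]) J := by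
    rintro (n | w | i) h
    · rw [step_mem_point] at *; omega
    · rw [node_mem_point] at *; exact h.trans (List.prefix_append _ _)
    · simp at h
  have hdiff : point (x + 1) (t ++ [true]) J \ point x t ∅ =
      insert (step (x + 1)) (insert (node (t ++ [true])) (J.image box)) := by
    ext (n | w | i)
    · simp; omega
    · simp only [Finset.mem_sdiff, node_mem_point, List.prefix_concat_iff, Finset.mem_insert,
        Finset.mem_image, reduceCtorEq, and_false, exists_false, or_false, false_or,
        Event.node.injEq]
      constructor
      · tauto
      · rintro rfl
        exact ⟨.inl rfl, fun H => by simpa using H.length_le⟩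
    · simp
  have hcard : (point (x + 1) (t ++ [true]) J \ point x t ∅).card = J.card + 2 := by
    rw [hdiff, Finset.card_insert_of_notMem (by simp), Finset.card_insert_of_notMem (by simp),
      Finset.card_image_of_injective _ fun a b h => Event.box.inj h]
  refine ⟨_, hcard ▸ (configs β ⊤).isCube_icc hsu fun w hw hw' => ⟨fun a ha b hab => ?_,
    fun a ha b hb => hu.2 a (hw' ha) b (hw' hb)⟩⟩
  by_cases has : a ∈ point x t ∅
  · exact hw (hs.1 a has b hab)
  · apply hw
    have hau := hw' ha
    cases hab with
    | step h => rw [step_mem_point] at *; omega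
    | @node a b h h' =>
      rw [node_mem_point, List.prefix_concat_iff] at hau
      rw [node_mem_point] at has ⊢
      rcases hau with rfl | hau
      · exact (List.prefix_concat_iff.1 h).resolve_left h'
      · exact absurd hau has
    | boxStep i =>
      rw [box_mem_point] at hau
      simpa using (h0 i hau).1
    | boxNode i =>
      rw [box_mem_point] at hau
      simpa using (h0 i hau).2.2.1

end Event

/-! ### Burling's construction with probes -/

/-- The word `t` lies in the subtree of the box. -/
def Box.InTree (β : Box) (t : List Bool) : Prop := β.top <+: t ∧ ∀ c ∈ β.cut, ¬ c <+: t

/-- A finite system of boxes with probes. The probe `p` starts at the point `(pos p, word p)` and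
extends to the right. -/
structure BoxSystem : Type 1 where
  ι : Type
  P : Type
  finite_ι : Finite ι
  finite_P : Finite P
  box : ι → Box
  width : ℕ
  pos : P → ℕ
  word : P → List Bool
  right_le : ∀ i, (box i).right ≤ width
  pos_lt : ∀ p, pos p + 1 < width
  eq_of_prefix : ∀ p q, word p <+: word q → p = q
  inTree_append : ∀ i p w, (box i).InTree (word p ++ w) ↔ (box i).InTree (word p)
  not_mem_start : ∀ i p, ¬ (box i).Mem (pos p) (word p)
  eq_of_mem_probe : ∀ p x, pos p ≤ x → ∀ i j, (box i).Mem x (word p) → (box j).Mem x (word p) →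
    i = j
  encard_le : ∀ x t, {i | (box i).Mem x t}.encard ≤ 2

namespace BoxSystem

variable (S : BoxSystem)

/-- The boxes that a probe runs through. -/
def through (p : S.P) : Set S.ι :=
  {i | (S.box i).InTree (S.word p) ∧ S.pos p < (S.box i).left ∧ (S.box i).left < (S.box i).right}

/-- A colouring of the boxes is proper if boxes that share a point have distinct colours. -/
def IsProper (γ : S.ι → ℕ) : Prop :=
  ∀ i j x t, i ≠ j → (S.box i).Mem x t → (S.box j).Mem x t → γ i ≠ γ j

/-- In every proper colouring some probe runs through boxes of at least `k` colours. -/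
def Forces (k : ℕ) : Prop :=
  ∀ γ, S.IsProper γ → ∃ p, (k : ℕ∞) ≤ (γ '' S.through p).encard

theorem eq_of_prefix_of_prefix {p q : S.P} {t : List Bool} (hp : S.word p <+: t)
    (hq : S.word q <+: t) : p = q := by
  rcases List.prefix_or_prefix_of_prefix hp hq with h | h
  · exact S.eq_of_prefix _ _ h
  · exact (S.eq_of_prefix _ _ h).symm

/-- The system without boxes and with a single probe. -/
def base : BoxSystem where
  ι := Empty
  P := Unit
  finite_ι := inferInstance
  finite_P := inferInstance
  box := Empty.elim
  -- The condition `pos p + 1 < width` keeps the interval `[pos p + 1, width)` of a diagonal box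
  -- nonempty.
  width := 2
  pos _ := 0
  word _ := []
  right_le i := i.elim
  pos_lt _ := by simp
  eq_of_prefix _ _ _ := rfl
  inTree_append i := i.elim
  not_mem_start i := i.elim
  eq_of_mem_probe _ _ _ i := i.elim
  encard_le x t := by simp [Set.eq_empty_of_isEmpty]

/-- The boxes of the next system: a stretched copy of the given boxes, a small copy of the given
boxes at the start of each probe, and a diagonal box at each probe of each small copy. -/
def nextBox : S.ι ⊕ (S.P × S.ι) ⊕ (S.P × S.P) → Box
  | .inl i => ⟨(S.box i).left * S.width, (S.box i).right * S.width, (S.box i).top, (S.box i).cut⟩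
  | .inr (.inl (p, i)) => ⟨S.pos p * S.width + (S.box i).left, S.pos p * S.width + (S.box i).right,
      S.word p ++ (S.box i).top, {c | (∃ c' ∈ (S.box i).cut, c = S.word p ++ c') ∨
        ∃ q, c = S.word p ++ (S.word q ++ [false])}⟩
  | .inr (.inr (p, q)) => ⟨S.pos p * S.width + (S.pos q + 1), S.pos p * S.width + S.width,
      S.word p ++ S.word q, {S.word p ++ (S.word q ++ [true])}⟩

theorem width_pos (p : S.P) : 0 < S.width := by have := S.pos_lt p; omega

theorem mem_outer {i : S.ι} {x : ℕ} {t : List Bool} (h : 0 < S.width) :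
    (S.nextBox (.inl i)).Mem x t ↔ (S.box i).Mem (x / S.width) t := by
  simp only [Box.Mem, nextBox, Nat.le_div_iff_mul_le h, Nat.div_lt_iff_lt_mul h]

theorem inTree_copy {p : S.P} {i : S.ι} {t : List Bool} :
    (S.nextBox (.inr (.inl (p, i)))).InTree t ↔ ∃ t', t = S.word p ++ t' ∧
      (S.box i).InTree t' ∧ ∀ q, ¬ S.word q ++ [false] <+: t' := by
  simp only [Box.InTree, nextBox]
  constructor
  · rintro ⟨⟨t', rfl⟩, h⟩
    rw [List.append_assoc] at h
    refine ⟨(S.box i).top ++ t', by simp, ⟨List.prefix_append _ _, fun c hc hct => ?_⟩,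
      fun q hq => ?_⟩
    · exact h _ (.inl ⟨c, hc, rfl⟩) ((List.prefix_append_right_inj _).2 hct)
    · exact h _ (.inr ⟨q, rfl⟩) ((List.prefix_append_right_inj _).2 hq)
  · rintro ⟨t', rfl, ⟨h1, h2⟩, h3⟩
    refine ⟨(List.prefix_append_right_inj _).2 h1, ?_⟩
    rintro _ (⟨c, hc, rfl⟩ | ⟨q, rfl⟩) h
    · exact h2 c hc ((List.prefix_append_right_inj _).1 h)
    · exact h3 q ((List.prefix_append_right_inj _).1 h)

theorem inTree_diag {p q : S.P} {t : List Bool} :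
    (S.nextBox (.inr (.inr (p, q)))).InTree t ↔ ∃ t', t = S.word p ++ (S.word q ++ t') ∧
      ¬ [true] <+: t' := by
  simp only [Box.InTree, nextBox, Set.mem_singleton_iff, forall_eq]
  constructor
  · rintro ⟨⟨t', rfl⟩, h⟩
    refine ⟨t', by simp, fun H => h ?_⟩
    rw [List.append_assoc]
    exact (List.prefix_append_right_inj _).2 ((List.prefix_append_right_inj _).2 H)
  · rintro ⟨t', rfl, h⟩
    refine ⟨⟨t', by simp⟩, fun H => h ?_⟩
    exact (List.prefix_append_right_inj _).1 ((List.prefix_append_right_inj _).1 H)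

theorem inTree_outer_probe {i : S.ι} {p : S.P} {t : List Bool} :
    (S.nextBox (.inl i)).InTree (S.word p ++ t) ↔ (S.box i).InTree (S.word p) :=
  S.inTree_append i p t

/-- The extra cuts split the probe `q` of the copy at `p` in two: the branch `true` keeps the boxes
of the copy, the branch `false` leaves them for the diagonal box. -/
theorem inTree_copy_probe {i : S.ι} {p p' q : S.P} {b : Bool} {t : List Bool} :
    (S.nextBox (.inr (.inl (p', i)))).InTree (S.word p ++ (S.word q ++ b :: t)) ↔
      p' = p ∧ (S.box i).InTree (S.word q) ∧ b = true := by
  rw [inTree_copy]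
  constructor
  · rintro ⟨t', h, h1, h2⟩
    obtain rfl : p' = p := S.eq_of_prefix_of_prefix ⟨t', h.symm⟩ (List.prefix_append _ _)
    obtain rfl := List.append_cancel_left h
    refine ⟨rfl, (S.inTree_append _ _ _).1 h1, ?_⟩
    by_contra hb
    obtain rfl : b = false := by simpa using hb
    exact h2 q ((List.prefix_append_right_inj _).2 ⟨t, rfl⟩)
  · rintro ⟨rfl, h, rfl⟩
    refine ⟨_, rfl, (S.inTree_append _ _ _).2 h, fun q' hq' => ?_⟩
    obtain rfl : q' = q := S.eq_of_prefix_of_prefix ((List.prefix_append _ _).trans hq')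
      (List.prefix_append _ _)
    have := (List.prefix_append_right_inj _).1 hq'
    simp at this

theorem inTree_diag_probe {p p' q q' : S.P} {b : Bool} {t : List Bool} :
    (S.nextBox (.inr (.inr (p', q')))).InTree (S.word p ++ (S.word q ++ b :: t)) ↔
      p' = p ∧ q' = q ∧ b = false := by
  rw [inTree_diag]
  constructor
  · rintro ⟨t', h, h1⟩
    obtain rfl : p' = p := S.eq_of_prefix_of_prefix ⟨_, h.symm⟩ (List.prefix_append _ _)
    have h := List.append_cancel_left h
    obtain rfl : q' = q := S.eq_of_prefix_of_prefix ⟨_, h.symm⟩ (List.prefix_append _ _)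
    obtain rfl := List.append_cancel_left h
    refine ⟨rfl, rfl, ?_⟩
    by_contra hb
    obtain rfl : b = true := by simpa using hb
    exact h1 ⟨t, rfl⟩
  · rintro ⟨rfl, rfl, rfl⟩
    exact ⟨_, rfl, by simp⟩

/-- A point of a small copy or of a diagonal box at `p` lies in the window of `p`. -/
theorem div_eq_of_window {p : S.P} {x : ℕ} (h1 : S.pos p * S.width ≤ x)
    (h2 : x < S.pos p * S.width + S.width) : x / S.width = S.pos p :=
  Nat.div_eq_of_lt_le h1 (by rwa [Nat.succ_mul])

theorem window_copy {p : S.P} {i : S.ι} {x : ℕ} {t : List Bool}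
    (h : (S.nextBox (.inr (.inl (p, i)))).Mem x t) : x / S.width = S.pos p := by
  have h1 := h.1
  have h2 := h.2.1
  have h3 := S.right_le i
  simp only [nextBox] at h1 h2
  exact S.div_eq_of_window (by omega) (by omega)

theorem window_diag {p q : S.P} {x : ℕ} {t : List Bool}
    (h : (S.nextBox (.inr (.inr (p, q)))).Mem x t) : x / S.width = S.pos p := by
  have h1 := h.1
  have h2 := h.2.1
  simp only [nextBox] at h1 h2
  exact S.div_eq_of_window (by omega) (by omega)

theorem mem_copy {p : S.P} {i : S.ι} {x : ℕ} {t : List Bool}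
    (h : (S.nextBox (.inr (.inl (p, i)))).Mem x t) : ∃ t', t = S.word p ++ t' ∧
      (S.box i).Mem (x - S.pos p * S.width) t' := by
  obtain ⟨t', ht, h', -⟩ := S.inTree_copy.1 h.2.2
  have h1 := h.1
  have h2 := h.2.1
  simp only [nextBox] at h1 h2
  exact ⟨t', ht, by omega, by omega, h'⟩

/-- Stretching turns the start of the probe `p` into a window of length `width`, still free of
stretched boxes; the small copy is placed there. -/
theorem not_mem_outer {i : S.ι} {p : S.P} {x : ℕ} {t : List Bool} (hx : x / S.width = S.pos p)
    (ht : S.word p <+: t) : ¬ (S.nextBox (.inl i)).Mem x t := by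
  intro h
  rw [S.mem_outer (S.width_pos p), hx] at h
  obtain ⟨t', rfl⟩ := ht
  exact S.not_mem_start i p ⟨h.1, h.2.1, (S.inTree_append _ _ _).1 h.2.2⟩

/-- Outside the windows only stretched boxes occur, inside only those attached to `p`. Strictly past
the start of a probe `q` of the copy there is at most one box of the copy and one diagonal box;
elsewhere in the window only boxes of the copy. -/
theorem encard_next_le (x : ℕ) (t : List Bool) : {j | (S.nextBox j).Mem x t}.encard ≤ 2 := by
  classical
  by_cases hP : ∃ p, S.word p <+: t ∧ x / S.width = S.pos p
  · obtain ⟨p, ⟨t, rfl⟩, hx⟩ := hP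
    have hM := S.width_pos p
    by_cases hQ : ∃ q, S.word q <+: t ∧ S.pos q < x - S.pos p * S.width
    · obtain ⟨q, ⟨t, rfl⟩, hxq⟩ := hQ
      have hsub : {j | (S.nextBox j).Mem x (S.word p ++ (S.word q ++ t))} ⊆
          insert (.inr (.inr (p, q))) ((fun i => .inr (.inl (p, i))) ''
            {i | (S.box i).Mem (x - S.pos p * S.width) (S.word q)}) := by
        rintro (i | ⟨p', i⟩ | ⟨p', q'⟩) hj
        · exact absurd hj (S.not_mem_outer hx (List.prefix_append _ _))
        · obtain ⟨t', ht', h⟩ := S.mem_copy hj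
          obtain rfl : p' = p := S.eq_of_prefix_of_prefix ⟨_, ht'.symm⟩ (List.prefix_append _ _)
          obtain rfl := List.append_cancel_left ht'
          exact .inr ⟨i, ⟨h.1, h.2.1, (S.inTree_append _ _ _).1 h.2.2⟩, rfl⟩
        · obtain ⟨t', ht', -⟩ := S.inTree_diag.1 hj.2.2
          obtain rfl : p' = p := S.eq_of_prefix_of_prefix ⟨_, ht'.symm⟩ (List.prefix_append _ _)
          have ht' := List.append_cancel_left ht'
          obtain rfl : q' = q := S.eq_of_prefix_of_prefix ⟨_, ht'.symm⟩ (List.prefix_append _ _)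
          exact .inl rfl
      refine (Set.encard_le_encard hsub).trans ((Set.encard_insert_le _ _).trans ?_)
      have h1 : {i | (S.box i).Mem (x - S.pos p * S.width) (S.word q)}.encard ≤ 1 :=
        Set.encard_le_one_iff.2 fun i j hi hj => S.eq_of_mem_probe q _ hxq.le i j hi hj
      exact (add_le_add_left ((Set.encard_image_le _ _).trans h1) 1).trans
        (by norm_num)
    · have hsub : {j | (S.nextBox j).Mem x (S.word p ++ t)} ⊆
          (fun i => .inr (.inl (p, i))) '' {i | (S.box i).Mem (x - S.pos p * S.width) t} := by
        rintro (i | ⟨p', i⟩ | ⟨p', q'⟩) hj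
        · exact absurd hj (S.not_mem_outer hx (List.prefix_append _ _))
        · obtain ⟨t', ht', h⟩ := S.mem_copy hj
          obtain rfl : p' = p := S.eq_of_prefix_of_prefix ⟨_, ht'.symm⟩ (List.prefix_append _ _)
          obtain rfl := List.append_cancel_left ht'
          exact ⟨i, h, rfl⟩
        · obtain ⟨t', ht', -⟩ := S.inTree_diag.1 hj.2.2
          obtain rfl : p' = p := S.eq_of_prefix_of_prefix ⟨_, ht'.symm⟩ (List.prefix_append _ _)
          have ht' := List.append_cancel_left ht'
          have := hj.1
          simp only [nextBox] at this
          exact absurd ⟨q', ⟨t', ht'.symm⟩, by omega⟩ hQ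
      exact (Set.encard_le_encard hsub).trans
        ((Set.encard_image_le _ _).trans (S.encard_le _ _))
  · have hsub : {j | (S.nextBox j).Mem x t} ⊆
        Sum.inl '' {i | (S.box i).Mem (x / S.width) t} := by
      rintro (i | ⟨p', i⟩ | ⟨p', q'⟩) hj
      · refine ⟨i, (S.mem_outer (Nat.pos_of_ne_zero fun h0 => ?_)).1 hj, rfl⟩
        have := hj.2.1
        simp [nextBox, h0] at this
      · obtain ⟨t', ht', h⟩ := S.mem_copy hj
        exact absurd ⟨p', ⟨t', ht'.symm⟩, S.window_copy hj⟩ hP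
      · obtain ⟨t', ht', -⟩ := S.inTree_diag.1 hj.2.2
        exact absurd ⟨p', ⟨_, ht'.symm⟩, S.window_diag hj⟩ hP
    exact (Set.encard_le_encard hsub).trans
      ((Set.encard_image_le _ _).trans (S.encard_le _ _))

/-- The next system in Burling's construction. -/
def next : BoxSystem where
  ι := S.ι ⊕ (S.P × S.ι) ⊕ (S.P × S.P)
  P := S.P × S.P × Bool
  finite_ι := by
    have := S.finite_ι
    have := S.finite_P
    infer_instance
  finite_P := by
    have := S.finite_P
    infer_instance
  box := S.nextBox
  width := S.width * S.width
  pos := fun (p, q, _) => S.pos p * S.width + S.pos q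
  word := fun (p, q, b) => S.word p ++ (S.word q ++ [b])
  right_le := by
    have hle : ∀ p, S.pos p * S.width + S.width ≤ S.width * S.width := fun p => by
      rw [← Nat.succ_mul]
      exact Nat.mul_le_mul_right _ (by have := S.pos_lt p; omega)
    rintro (i | ⟨p, i⟩ | ⟨p, q⟩)
    · exact Nat.mul_le_mul_right _ (S.right_le i)
    · have := S.right_le i
      have := hle p
      simp only [nextBox]
      omega
    · exact hle p
  pos_lt := by
    rintro ⟨p, q, b⟩
    have h1 : S.pos p * S.width + S.width ≤ S.width * S.width := by
      rw [← Nat.succ_mul]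
      exact Nat.mul_le_mul_right _ (by have := S.pos_lt p; omega)
    have := S.pos_lt q
    simp only
    omega
  eq_of_prefix := by
    rintro ⟨p, q, b⟩ ⟨p', q', b'⟩ h
    obtain rfl := S.eq_of_prefix_of_prefix ((List.prefix_append _ _).trans h)
      (List.prefix_append _ _)
    have h := (List.prefix_append_right_inj _).1 h
    obtain rfl := S.eq_of_prefix_of_prefix ((List.prefix_append _ _).trans h)
      (List.prefix_append _ _)
    have h := (List.prefix_append_right_inj _).1 h
    simp at h
    rw [h]
  inTree_append := by
    rintro (i | ⟨p', i⟩ | ⟨p', q'⟩) ⟨p, q, b⟩ w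
    · simp only [List.append_assoc, inTree_outer_probe]
    · simp only [List.append_assoc, List.cons_append, List.nil_append, inTree_copy_probe]
    · simp only [List.append_assoc, List.cons_append, List.nil_append, inTree_diag_probe]
  not_mem_start := by
    rintro (i | ⟨p', i⟩ | ⟨p', q'⟩) ⟨p, q, b⟩ h
    · have := S.pos_lt q
      exact S.not_mem_outer (S.div_eq_of_window (by simp) (by simp; omega))
        (List.prefix_append _ _) h
    · obtain ⟨rfl, hi, -⟩ := S.inTree_copy_probe.1 h.2.2
      have h1 := h.1
      have h2 := h.2.1
      simp only [nextBox] at h1 h2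
      exact S.not_mem_start i q ⟨by omega, by omega, hi⟩
    · obtain ⟨rfl, rfl, -⟩ := S.inTree_diag_probe.1 h.2.2
      have h1 := h.1
      simp only [nextBox] at h1
      omega
  eq_of_mem_probe := by
    rintro ⟨p, q, b⟩ x hx
    have hM := S.width_pos p
    have hxp : S.pos p ≤ x / S.width := (Nat.le_div_iff_mul_le hM).2 (by simp only at hx; omega)
    have hcopy : ∀ {p' i}, (S.nextBox (.inr (.inl (p', i)))).Mem x
        (S.word p ++ (S.word q ++ [b])) → p' = p ∧ b = true ∧ x / S.width = S.pos p ∧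
        (S.box i).Mem (x - S.pos p * S.width) (S.word q) := by
      intro p' i h
      obtain ⟨rfl, hi, rfl⟩ := S.inTree_copy_probe.1 h.2.2
      have h1 := h.1
      have h2 := h.2.1
      simp only [nextBox] at h1 h2
      exact ⟨rfl, rfl, S.window_copy h, by omega, by omega, hi⟩
    have hdiag : ∀ {p' q'}, (S.nextBox (.inr (.inr (p', q')))).Mem x
        (S.word p ++ (S.word q ++ [b])) → p' = p ∧ q' = q ∧ b = false ∧
          x / S.width = S.pos p := by
      intro p' q' h
      obtain ⟨rfl, rfl, rfl⟩ := S.inTree_diag_probe.1 h.2.2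
      exact ⟨rfl, rfl, rfl, S.window_diag h⟩
    have hout : ∀ {i}, x / S.width = S.pos p →
        ¬ (S.nextBox (.inl i)).Mem x (S.word p ++ (S.word q ++ [b])) :=
      fun h => S.not_mem_outer h (List.prefix_append _ _)
    -- Mixed pairs are impossible: stretched boxes avoid the window, and on the probe copies need `b
    -- = true` while diagonals need `b = false`.
    rintro (i | ⟨p₁, i⟩ | ⟨p₁, q₁⟩) (j | ⟨p₂, j⟩ | ⟨p₂, q₂⟩) hi hj
    · rw [S.mem_outer hM] at hi hj
      rw [S.eq_of_mem_probe p _ hxp i j ⟨hi.1, hi.2.1, S.inTree_outer_probe.1 hi.2.2⟩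
        ⟨hj.1, hj.2.1, S.inTree_outer_probe.1 hj.2.2⟩]
    · exact absurd hi (hout (hcopy hj).2.2.1)
    · exact absurd hi (hout (hdiag hj).2.2.2)
    · exact absurd hj (hout (hcopy hi).2.2.1)
    · obtain ⟨rfl, -, -, hi⟩ := hcopy hi
      obtain ⟨rfl, -, -, hj⟩ := hcopy hj
      simp only at hx
      rw [S.eq_of_mem_probe q _ (by omega) i j hi hj]
    · have h1 := (hcopy hi).2.1
      have h2 := (hdiag hj).2.2.1
      simp [h1] at h2
    · exact absurd hj (hout (hdiag hi).2.2.2)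
    · have h1 := (hcopy hj).2.1
      have h2 := (hdiag hi).2.2.1
      simp [h1] at h2
    · obtain ⟨rfl, rfl, -⟩ := hdiag hi
      obtain ⟨rfl, rfl, -⟩ := hdiag hj
      rfl
  encard_le := S.encard_next_le

theorem mem_copy_of_mem {p : S.P} {i : S.ι} {x : ℕ} {t : List Bool} (h : (S.box i).Mem x t)
    (ht : ∀ q, ¬ S.word q ++ [false] <+: t) :
    (S.nextBox (.inr (.inl (p, i)))).Mem (S.pos p * S.width + x) (S.word p ++ t) :=
  ⟨Nat.add_le_add_left h.1 _, Nat.add_lt_add_left h.2.1 _, S.inTree_copy.2 ⟨t, rfl, h.2.2, ht⟩⟩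

theorem not_prefix_word (q q' : S.P) (b : Bool) : ¬ S.word q' ++ [b] <+: S.word q := by
  intro h
  obtain rfl := S.eq_of_prefix _ _ ((List.prefix_append _ _).trans h)
  simpa using h.length_le

/-- Let `A` be the colours of the stretched boxes on a good probe `p`, `B` those of the copy at `p`
on a good probe `q`, and `d` the colour of the diagonal box, which is not in `B`. If `B` is not
contained in `A`, the branch `true` sees a colour beyond `A`; if `d` is not in `A`, the branch
`false` does. Otherwise `B` is properly contained in `A`, so `A` alone has at least `k + 1` colours.
-/
theorem Forces.next {S : BoxSystem} {k : ℕ} (hS : S.Forces k) : S.next.Forces (k + 1) := by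
  intro γ hγ
  obtain ⟨p, hp⟩ := hS (fun i => γ (.inl i)) (by
    intro i j x t hij hi hj
    have hM : 0 < S.width := by
      have := hi.2.1
      have := S.right_le i
      omega
    refine hγ (.inl i) (.inl j) (x * S.width) t (fun h => hij (Sum.inl.inj h)) ?_ ?_
    · exact (S.mem_outer hM).2 (by rwa [Nat.mul_div_cancel _ hM])
    · exact (S.mem_outer hM).2 (by rwa [Nat.mul_div_cancel _ hM]))
  obtain ⟨q, hq⟩ := hS (fun i => γ (.inr (.inl (p, i)))) (by
    intro i j x t hij hi hj
    have hne : (.inr (.inl (p, i)) : S.next.ι) ≠ .inr (.inl (p, j)) :=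
      fun h => hij (Prod.mk.inj (Sum.inl.inj (Sum.inr.inj h))).2
    -- A common point that the extra cuts remove is moved up to `word q`, which lies in the same
    -- boxes of `S` and is not cut.
    by_cases H : ∃ q, S.word q ++ [false] <+: t
    · obtain ⟨q, hq⟩ := H
      obtain ⟨t, rfl⟩ := (List.prefix_append _ _).trans hq
      have hi' : (S.box i).Mem x (S.word q) := ⟨hi.1, hi.2.1, (S.inTree_append _ _ _).1 hi.2.2⟩
      have hj' : (S.box j).Mem x (S.word q) := ⟨hj.1, hj.2.1, (S.inTree_append _ _ _).1 hj.2.2⟩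
      exact hγ _ _ _ _ hne
        (S.mem_copy_of_mem hi' fun q' => S.not_prefix_word _ _ _)
        (S.mem_copy_of_mem hj' fun q' => S.not_prefix_word _ _ _)
    · push Not at H
      exact hγ _ _ _ _ hne (S.mem_copy_of_mem hi H) (S.mem_copy_of_mem hj H))
  have hM := S.width_pos p
  have hqM := S.pos_lt q
  have houter : ∀ b, ∀ i ∈ S.through p, (.inl i : S.next.ι) ∈ S.next.through (p, q, b) := by
    rintro b i ⟨h1, h2, h3⟩
    refine ⟨S.inTree_outer_probe.2 h1, ?_, Nat.mul_lt_mul_of_pos_right h3 hM⟩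
    have := Nat.mul_le_mul_right S.width h2
    rw [Nat.succ_mul] at this
    simp only [BoxSystem.next, nextBox]
    omega
  have hcopy : ∀ i ∈ S.through q, (.inr (.inl (p, i)) : S.next.ι) ∈ S.next.through (p, q, true) := by
    rintro i ⟨h1, h2, h3⟩
    refine ⟨S.inTree_copy_probe.2 ⟨rfl, h1, rfl⟩, ?_, ?_⟩
    · simp only [BoxSystem.next, nextBox]; omega
    · simp only [BoxSystem.next, nextBox]; omega
  have hdiag : (.inr (.inr (p, q)) : S.next.ι) ∈ S.next.through (p, q, false) := by
    refine ⟨S.inTree_diag_probe.2 ⟨rfl, rfl, rfl⟩, ?_, ?_⟩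
    · simp only [BoxSystem.next, nextBox]; omega
    · simp only [BoxSystem.next, nextBox]; omega
  -- The tree part of the diagonal box starts at `word p ++ word q`, above the splitting. Hence it
  -- meets there every copied box that `q` runs through, at the left end of that box.
  have hnew : γ (.inr (.inr (p, q))) ∉ (fun i => γ (.inr (.inl (p, i)))) '' S.through q := by
    rintro ⟨i, ⟨h1, h2, h3⟩, heq⟩
    refine hγ (.inr (.inl (p, i))) (.inr (.inr (p, q))) (S.pos p * S.width + (S.box i).left)
      (S.word p ++ S.word q) (fun h => nomatch Sum.inr.inj h) ?_ ?_ heq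
    · exact S.mem_copy_of_mem ⟨le_rfl, h3, h1⟩ fun q' => S.not_prefix_word _ _ _
    · have := S.right_le i
      refine ⟨?_, ?_, S.inTree_diag.2 ⟨[], by simp, by simp⟩⟩
      · simp only [BoxSystem.next, nextBox]; omega
      · simp only [BoxSystem.next, nextBox]; omega
  have hfin : ((fun i => γ (.inl i)) '' S.through p).Finite := by
    have := S.finite_ι
    exact Set.toFinite _
  have hext : ∀ b m, m ∉ (fun i => γ (.inl i)) '' S.through p →
      m ∈ γ '' S.next.through (p, q, b) →
      ((k + 1 : ℕ) : ℕ∞) ≤ (γ '' S.next.through (p, q, b)).encard := by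
    intro b m hm hm'
    have hsub : insert m ((fun i => γ (.inl i)) '' S.through p) ⊆
        γ '' S.next.through (p, q, b) := by
      rintro _ (rfl | ⟨i, hi, rfl⟩)
      · exact hm'
      · exact ⟨_, houter b i hi, rfl⟩
    refine le_trans ?_ (Set.encard_le_encard hsub)
    rw [Set.encard_insert_of_notMem hm]
    push_cast
    exact add_le_add_left hp 1
  by_cases hsub : (fun i => γ (.inr (.inl (p, i)))) '' S.through q ⊆
      (fun i => γ (.inl i)) '' S.through p
  · by_cases hd : γ (.inr (.inr (p, q))) ∈ (fun i => γ (.inl i)) '' S.through p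
    · refine ⟨(p, q, false), ?_⟩
      have hlt := (hfin.subset hsub).encard_lt_encard ⟨hsub, fun H => hnew (H hd)⟩
      refine le_trans ?_ (Set.encard_le_encard (s := (fun i => γ (.inl i)) '' S.through p) ?_)
      · push_cast
        exact (add_le_add_left hq 1).trans (Order.add_one_le_of_lt hlt)
      · rintro _ ⟨i, hi, rfl⟩
        exact ⟨_, houter false i hi, rfl⟩
    · exact ⟨_, hext false _ hd ⟨_, hdiag, rfl⟩⟩
  · obtain ⟨_, ⟨i, hi, rfl⟩, hm⟩ := Set.not_subset.1 hsub
    exact ⟨_, hext true _ hm ⟨_, hcopy i hi, rfl⟩⟩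

theorem exists_forces : ∀ k : ℕ, ∃ S : BoxSystem, S.Forces k
  | 0 => ⟨base, fun _ _ => ⟨(), by simp⟩⟩
  | k + 1 => by
    obtain ⟨S, hS⟩ := exists_forces k
    exact ⟨S.next, hS.next⟩

end BoxSystem

/-! ### One family of boxes for all numbers of colours -/

/-- The words `1ⁿ0`, no two of which have a common extension. -/
def branch (k : ℕ) : List Bool := List.replicate k true ++ [false]

theorem branch_inj {k l : ℕ} {t : List Bool} (hk : branch k <+: t) (hl : branch l <+: t) :
    k = l := by
  induction k generalizing l t with
  | zero =>
    cases l with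
    | zero => rfl
    | succ l =>
      cases t with
      | nil => simp [branch] at hk
      | cons b t => simp_all [branch, List.replicate_succ]
  | succ k ih =>
    cases t with
    | nil => simp [branch] at hk
    | cons b t =>
      cases l with
      | zero => simp_all [branch, List.replicate_succ]
      | succ l =>
        simp only [branch, List.replicate_succ, List.cons_append, List.cons_prefix_cons] at hk hl
        rw [ih hk.2 hl.2]

/-- The box moved to the subtree below the word `w`. -/
def Box.below (β : Box) (w : List Bool) : Box where
  left := β.left
  right := β.right
  top := w ++ β.top
  cut := (w ++ ·) '' β.cut

theorem Box.mem_below {β : Box} {w : List Bool} {x : ℕ} {t : List Bool} :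
    (β.below w).Mem x t ↔ ∃ t', t = w ++ t' ∧ β.Mem x t' := by
  simp only [Box.Mem, Box.below, Set.forall_mem_image]
  constructor
  · rintro ⟨h1, h2, ⟨t', rfl⟩, h⟩
    rw [List.append_assoc] at h
    exact ⟨β.top ++ t', by simp, h1, h2, List.prefix_append _ _, fun c hc hct =>
      h hc ((List.prefix_append_right_inj _).2 hct)⟩
  · rintro ⟨t', rfl, h1, h2, h3, h4⟩
    exact ⟨h1, h2, (List.prefix_append_right_inj _).2 h3, fun c hc hct =>
      h4 c hc ((List.prefix_append_right_inj _).1 hct)⟩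

/-- There is a family of boxes of which at most three share a point and which has no finite
proper colouring. Moreover three of the boxes share a square. -/
theorem exists_boxes : ∃ (ι : Type) (β : ι → Box), (∀ x t, {i | (β i).Mem x t}.encard ≤ 3) ∧
    (∀ N : ℕ, {i | (β i).top.length ≤ N}.Finite) ∧
    (∃ J : Finset ι, J.card = 3 ∧ ∀ i ∈ J, ∀ x ≤ 1, ∀ t, [false] <+: t → (β i).Mem x t) ∧
    ∀ n : ℕ, ∃ N : ℕ, ∀ γ : ι → Fin (n + 1), ∃ i j x t, i ≠ j ∧ x ≤ N ∧ List.length t ≤ N ∧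
      (β i).Mem x t ∧ (β j).Mem x t ∧ γ i = γ j := by
  classical
  choose S hS using BoxSystem.exists_forces
  have hfin : ∀ k, Finite (S k).ι := fun k => (S k).finite_ι
  -- Branch `k + 1` carries the system forcing `k` colours; branch `0` carries three equal boxes,
  -- which serve only to attain dimension 5.
  let β : Fin 3 ⊕ (Σ k, (S k).ι) → Box := fun i =>
    i.elim (fun _ => ⟨0, 2, branch 0, ∅⟩) fun i => ((S i.1).box i.2).below (branch (i.1 + 1))
  have hβ : ∀ k i x t, (β (.inr ⟨k, i⟩)).Mem x t ↔
      ∃ t', t = branch (k + 1) ++ t' ∧ ((S k).box i).Mem x t' := fun k i x t => Box.mem_below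
  refine ⟨_, β, ?_, ?_, ?_, ?_⟩
  · intro x t
    by_cases h0 : branch 0 <+: t
    · have hsub : {i | (β i).Mem x t} ⊆ Set.range Sum.inl := by
        rintro (i | ⟨k, i⟩) hi
        · exact ⟨i, rfl⟩
        · obtain ⟨t', rfl, -⟩ := (hβ _ _ _ _).1 hi
          exact absurd (branch_inj h0 (List.prefix_append _ _)) (by simp)
      refine (Set.encard_le_encard hsub).trans ?_
      rw [← Set.image_univ]
      refine (Set.encard_image_le _ _).trans ?_
      simp
    · by_cases h1 : ∃ k, branch (k + 1) <+: t
      · obtain ⟨k, t, rfl⟩ := h1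
        have hsub : {i | (β i).Mem x (branch (k + 1) ++ t)} ⊆
            (fun i => .inr ⟨k, i⟩) '' {i | ((S k).box i).Mem x t} := by
          rintro (i | ⟨l, i⟩) hi
          · exact absurd hi.2.2.1 h0
          · obtain ⟨t', ht', h⟩ := (hβ _ _ _ _).1 hi
            have hl : k + 1 = l + 1 := branch_inj (List.prefix_append _ _) ⟨t', ht'.symm⟩
            obtain rfl : k = l := by omega
            obtain rfl := List.append_cancel_left ht'
            exact ⟨i, h, rfl⟩
        refine (Set.encard_le_encard hsub).trans ((Set.encard_image_le _ _).trans
          (((S k).encard_le x t).trans (by norm_num)))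
      · have : {i | (β i).Mem x t} = ∅ := by
          ext i
          simp only [Set.mem_empty_iff_false, iff_false]
          rintro hi
          rcases i with i | ⟨k, i⟩
          · exact h0 hi.2.2.1
          · obtain ⟨t', rfl, -⟩ := (hβ _ _ _ _).1 hi
            exact h1 ⟨k, List.prefix_append _ _⟩
        simp [this]
  · intro N
    refine ((Set.finite_range Sum.inl).union ((Set.finite_lt_nat N).biUnion fun k _ =>
      Set.finite_range fun i : (S k).ι =>
        (Sum.inr ⟨k, i⟩ : Fin 3 ⊕ (Σ k, (S k).ι)))).subset ?_
    rintro (i | ⟨k, i⟩) hi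
    · exact .inl ⟨i, rfl⟩
    · refine .inr (Set.mem_biUnion (x := k) ?_ ⟨i, rfl⟩)
      have : (branch (k + 1) ++ ((S k).box i).top).length ≤ N := hi
      simp only [branch, List.length_append, List.length_replicate] at this
      change k < N
      omega
  · refine ⟨Finset.univ.image Sum.inl, by
      rw [Finset.card_image_of_injective _ Sum.inl_injective]; simp, ?_⟩
    intro i hi x hx t ht
    obtain ⟨i, -, rfl⟩ := Finset.mem_image.1 hi
    exact ⟨Nat.zero_le _, Nat.lt_succ_of_le hx, ht, fun c hc => hc.elim⟩
  · intro n
    -- One colour more than `Fin (n + 1)` offers.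
    let T := S (n + 2)
    -- A witness point is fixed for each of the finitely many pairs of boxes that meet; `N` bounds
    -- them all, so truncation at `N` keeps every conflict of colours.
    have hex : ∀ ij : T.ι × T.ι, ∃ N, (∃ x t, (T.box ij.1).Mem x t ∧ (T.box ij.2).Mem x t) →
        ∃ x t, x ≤ N ∧ (branch (n + 3) ++ t).length ≤ N ∧ (T.box ij.1).Mem x t ∧
          (T.box ij.2).Mem x t := by
      intro ij
      by_cases h : ∃ x t, (T.box ij.1).Mem x t ∧ (T.box ij.2).Mem x t
      · obtain ⟨x, t, h⟩ := h
        exact ⟨max x (branch (n + 3) ++ t).length, fun _ =>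
          ⟨x, t, le_max_left _ _, le_max_right _ _, h⟩⟩
      · exact ⟨0, fun H => absurd H h⟩
    choose f hf using hex
    have : Finite T.ι := T.finite_ι
    obtain ⟨N, hN⟩ := (Set.finite_range f).bddAbove
    refine ⟨N, fun γ => ?_⟩
    by_contra! H
    obtain ⟨p, hp⟩ := hS (n + 2) (fun i => γ (.inr ⟨n + 2, i⟩)) (by
      intro i j x t hij hi hj heq
      obtain ⟨x, t, hx, ht, hi, hj⟩ := hf (i, j) ⟨x, t, hi, hj⟩
      have hle := hN ⟨(i, j), rfl⟩
      refine H (.inr ⟨n + 2, i⟩) (.inr ⟨n + 2, j⟩) x (branch (n + 3) ++ t) (by simpa using hij)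
        (hx.trans hle) (ht.trans hle) ((hβ _ _ _ _).2 ⟨t, rfl, hi⟩) ((hβ _ _ _ _).2 ⟨t, rfl, hj⟩)
        (Fin.ext heq))
    have hsub : (fun i => (γ (.inr ⟨n + 2, i⟩) : ℕ)) '' (S (n + 2)).through p ⊆
        (Finset.range (n + 1) : Set ℕ) := by
      rintro _ ⟨i, -, rfl⟩
      simp only [Finset.coe_range, Set.mem_Iio]
      exact (γ _).2
    have := hp.trans (Set.encard_le_encard hsub)
    rw [Set.encard_coe_eq_coe_finsetCard, Finset.card_range] at this
    have : n + 2 ≤ n + 1 := by exact_mod_cast this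
    omega

/-! ### Finiteness, chromatic number and conclusion -/

theorem CubeComplex.exists_hasMaxDegree {V : Type*} [Nonempty V] (X : CubeComplex V) {b : ℕ}
    (h : ∀ v, (X.skel.neighborSet v).encard ≤ b) : ∃ D ≤ b, X.HasMaxDegree D := by
  let A : Set ℕ := {d | ∃ v, (X.skel.neighborSet v).encard = d}
  have hle : ∀ d ∈ A, d ≤ b := by
    rintro d ⟨v, hv⟩
    exact_mod_cast hv ▸ h v
  have hA : ∀ v, ∃ d ∈ A, (X.skel.neighborSet v).encard = (d : ℕ∞) := by
    intro v
    obtain ⟨d, hd⟩ := ENat.ne_top_iff_exists.1 (ne_top_of_le_ne_top (ENat.natCast_ne_top b) (h v))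
    exact ⟨d, ⟨v, hd.symm⟩, hd.symm⟩
  obtain ⟨d₀, hd₀, -⟩ := hA (Classical.arbitrary V)
  have hmem := Nat.sSup_mem (s := A) ⟨d₀, hd₀⟩ ⟨b, hle⟩
  refine ⟨sSup A, hle _ hmem, hmem, ?_⟩
  rintro _ ⟨v, rfl⟩
  obtain ⟨d, hd, hvd⟩ := hA v
  simp only [hvd]
  exact_mod_cast le_csSup ⟨b, hle⟩ hd

namespace Event

variable {ι : Type} {β : ι → Box}

instance {N : ℕ∞} : Nonempty (configs β N).Vertex := ⟨⟨∅, (configs β N).empty⟩⟩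

/-- A box requires its top node, so the bound on nodes also leaves only finitely many boxes. -/
theorem finite_vertex (hβ : ∀ N : ℕ, {i | (β i).top.length ≤ N}.Finite) (N : ℕ) :
    Finite (configs β N).Vertex := by
  let A : Set (Event ι) := step '' {n | n ≤ N} ∪ node '' {w | w.length ≤ N} ∪
    box '' {i | (β i).top.length ≤ N}
  have hA : A.Finite := (((Set.finite_le_nat N).image _).union
    ((List.finite_length_le Bool N).image _)).union ((hβ N).image _)
  have hnode : ∀ (s : (configs β N).Vertex) (w), node w ∈ s.1 → w.length ≤ N := by
    intro s w hw
    by_contra H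
    exact s.2.2 _ hw _ hw (.nodeBound (by exact_mod_cast H))
  have hs : ∀ s : (configs β N).Vertex, (s.1 : Set (Event ι)) ⊆ A := by
    rintro s (n | w | i) he
    · refine .inl (.inl ⟨n, ?_, rfl⟩)
      by_contra H
      exact s.2.2 _ he _ he (.stepBound (by exact_mod_cast H))
    · exact .inl (.inr ⟨w, hnode s w he, rfl⟩)
    · exact .inr ⟨i, hnode s _ (s.2.1 _ he _ (.boxNode i)), rfl⟩
  have := hA.finite_subsets.to_subtype
  exact Finite.of_injective (β := {B | B ⊆ A}) (fun s => ⟨s.1, hs s⟩) fun s s' h =>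
    Subtype.ext (Finset.coe_injective (congrArg Subtype.val h))

theorem infinite_vertex : Infinite (configs β ⊤).Vertex := by
  refine Infinite.of_injective (fun n : ℕ => ⟨point n [] ∅, isConfig_point le_top le_top
    (by simp)⟩) fun m n h => ?_
  have h : point m [] ∅ = point n [] ∅ := congrArg Subtype.val h
  have h1 : step m ∈ point n [] (∅ : Finset ι) := by rw [← h]; simp
  have h2 : step n ∈ point m [] (∅ : Finset ι) := by rw [h]; simp
  rw [step_mem_point] at h1 h2
  omega

theorem not_colorable {n N₀ : ℕ} {N : ℕ∞} (hN : N₀ ≤ N)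
    (h : ∀ γ : ι → Fin (n + 1), ∃ i j x t, i ≠ j ∧ x ≤ N₀ ∧ List.length t ≤ N₀ ∧
      (β i).Mem x t ∧ (β j).Mem x t ∧ γ i = γ j) :
    ¬ (configs β N).complex.crossingGraph.Colorable n := by
  intro hc
  -- Passing to `n + 1` colours makes the set of colours nonempty even for `n = 0`.
  obtain ⟨γ, hγ⟩ := exists_coloring (hc.mono (Nat.le_succ n)).some
  obtain ⟨i, j, x, t, hij, hx, ht, hi, hj, heq⟩ := h γ
  exact hγ i j x t hij (le_trans (by exact_mod_cast hx) hN) (le_trans (by exact_mod_cast ht) hN)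
    hi hj heq

end Event

theorem theorem2 :
    (∃ D : ℕ, ∀ n : ℕ, ∃ (V : Type) (X : CubeComplex V),
      X.IsCAT0 ∧ Finite V ∧ X.HasMaxDegree D ∧
      (n : ℕ∞) < X.crossingGraph.chromaticNumber ∧
      ∀ k : ℕ, CubeComplex.EmbedsInTrees.{0, w} X k → n < k) ∧
    (∃ (V : Type) (X : CubeComplex V) (D : ℕ),
      X.IsCAT0 ∧ Infinite V ∧ X.HasDim 5 ∧ X.HasMaxDegree D ∧
      X.crossingGraph.chromaticNumber = ⊤ ∧
      ∀ k : ℕ, ¬ CubeComplex.EmbedsInTrees.{0, w} X k) := by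
  obtain ⟨ι, β, hβ, hfin, ⟨J, hJ, hJm⟩, hcol⟩ := exists_boxes
  choose N hN using hcol
  refine ⟨?_, ?_⟩
  · have hdeg := fun n => (Event.configs β (N n)).complex.exists_hasMaxDegree (b := 9)
      (Event.encard_neighborSet_le hβ)
    choose d hd hd' using hdeg
    -- The maximum degrees are at most 9 but may vary. By pigeonhole one value recurs for
    -- arbitrarily large `m`, and such an `m ≥ n` serves for `n`.
    obtain ⟨D, hD⟩ : ∃ D, ∀ n, ∃ m, n ≤ m ∧ d m = D := by
      by_contra! H
      choose f hf using H
      let m := (Finset.range 10).sup f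
      exact hf (d m) m (Finset.le_sup (Finset.mem_range.2 (Nat.lt_succ_of_le (hd m)))) rfl
    refine ⟨D, fun n => ?_⟩
    obtain ⟨m, hnm, hm⟩ := hD n
    have hnc : ¬ (Event.configs β (N m)).complex.crossingGraph.Colorable n := fun hc =>
      Event.not_colorable le_rfl (hN m) (hc.mono hnm)
    refine ⟨_, (Event.configs β (N m)).complex, ConfigFamily.isCAT0 _,
      Event.finite_vertex hfin _, hm ▸ hd' m, ?_, fun k hk => ?_⟩
    · rw [← not_le, SimpleGraph.chromaticNumber_le_iff_colorable]
      exact hnc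
    · by_contra hkn
      exact hnc (hk.colorable.mono (by omega))
  · have hnc : ∀ n, ¬ (Event.configs β ⊤).complex.crossingGraph.Colorable n := fun n =>
      Event.not_colorable le_top (hN n)
    obtain ⟨D, -, hD⟩ := (Event.configs β ⊤).complex.exists_hasMaxDegree (b := 9)
      (Event.encard_neighborSet_le hβ)
    refine ⟨_, (Event.configs β ⊤).complex, D, ConfigFamily.isCAT0 _, Event.infinite_vertex,
      ⟨?_, ?_⟩, hD, ?_, fun k hk => hnc k hk.colorable⟩
    · have h := Event.exists_isCube (β := β) (x := 0) (t := [false]) (J := J)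
        (fun i hi => hJm i hi 0 (by simp) _ (by simp)) (fun i hi => hJm i hi 1 le_rfl _ (by simp))
      rwa [hJ] at h
    · rintro d ⟨c, hc⟩
      exact Event.le_five_of_isCube hβ hc
    · by_contra h
      obtain ⟨n, hn⟩ := SimpleGraph.chromaticNumber_ne_top_iff_exists.1 h
      exact hnc n hn
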